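/- For every $K>0$ there exist constants $c_K,C_K>0$ and, for every $a\in\mathbb{R}$, a constant $C_{K,a}>0$, depending only on the indicated quantities, such that the following holds. Let $n\ge 2$, $p\ge 1$, $\lambda>0$, and let $\mathbf{X}$ be a mean-zero, $K$-subgaussian random vector in $\mathbb{R}^p$, i.e. $\|\langle \mathbf{X},\mathbf{x}\rangle\|_{\psi_2}\le K(\mathbb{E}\langle \mathbf{X},\mathbf{x}\rangle^2)^{1/2}$ for all $\mathbf{x}\in\mathbb{R}^p$, where $\|Y\|_{\psi_2}=\inf\{s>0:\mathbb{E}\exp(Y^2/s^2)\le 2\}$; let $\boldsymbol{\Sigma}=\mathbb{E}(\mathbf{X}\mathbf{X}^T)$ be its covariance matrix. Let $\mathbf{X}^1,\dots,\mathbf{X}^n$ be distributed as $\mathbf{X}$, let $\boldsymbol{\tau}^1,\bar{\boldsymbol{\tau}}^1,\dots,\boldsymbol{\tau}^n,\bar{\boldsymbol{\tau}}^n$ be uniformly distributed in $[-\lambda,\lambda]^p$, and let all these $3n$ random vectors be independent. Put $$\tilde{\boldsymbol{\Sigma}}'_n=\frac{\lambda^2}{n}\sum_{k=1}^n \mathrm{sign}(\mathbf{X}^k+\boldsymbol{\tau}^k)\,\mathrm{sign}(\mathbf{X}^k+\bar{\boldsymbol{\tau}}^k)^T,\qquad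 \tilde{\boldsymbol{\Sigma}}^{\mathrm{dith}}_n=\tfrac12\tilde{\boldsymbol{\Sigma}}'_n+\tfrac12(\tilde{\boldsymbol{\Sigma}}'_n)^T,$$ where $\mathrm{sign}$ acts entrywise, with $\mathrm{sign}(x)=1$ for $x\ge 0$ and $\mathrm{sign}(x)=-1$ for $x<0$. Let $\mathbf{M}\in[0,1]^{p\times p}$ be a fixed symmetric matrix, and let $t\ge 0$, with $t\ge 1$ in the case $p=1$. Denote by $\odot$ the entrywise product, by $\|\cdot\|$ the operator norm, by $\|\cdot\|_\infty$ the largest absolute value of an entry, and by $\|\cdot\|_{1\to 2}$ the largest Euclidean norm of a column. If $\lambda^2\ge c_K\log(n)\|\boldsymbol{\Sigma}\|_\infty$, then with probability at least $1-e^{-t}$ $$\|\mathbf{M}\odot\tilde{\boldsymbol{\Sigma}}^{\mathrm{dith}}_n-\mathbf{M}\odot\boldsymbol{\Sigma}\|\le C_K\left(\|\mathbf{M}\|_{1\to 2}\bigl(\lambda\|\boldsymbol{\Sigma}\|^{1/2}+\lambda^2\bigr)\sqrt{\frac{\log(p)+t}{n}}+\lambda^2\|\mathbf{M}\|\,\frac{\log(p)+t}{n}\right).$$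 If $c_K\log(n)\|\boldsymbol{\Sigma}\|_\infty\le\lambda^2\le a\log(n)\|\boldsymbol{\Sigma}\|_\infty$, then with probability at least $1-e^{-t}$ $$\|\mathbf{M}\odot\tilde{\boldsymbol{\Sigma}}^{\mathrm{dith}}_n-\mathbf{M}\odot\boldsymbol{\Sigma}\|\le C_{K,a}\left(\log(n)\|\mathbf{M}\|_{1\to 2}\sqrt{\frac{\|\boldsymbol{\Sigma}\|\,\|\boldsymbol{\Sigma}\|_\infty(\log(p)+t)}{n}}+\log(n)\|\mathbf{M}\|\,\|\boldsymbol{\Sigma}\|_\infty\frac{\log(p)+t}{n}\right).$$ -/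

import Mathlib

open MeasureTheory ProbabilityTheory
open scoped ENNReal Matrix

namespace DitheredCov

/-- The subgaussian norm `‖Y‖_{ψ₂} = inf {t > 0 : E exp (Y² / t²) ≤ 2}` of a real random variable,
with values in `[0, ∞]`; it is `∞` when there is no such `t`. -/
noncomputable def psi2Norm {Ω : Type*} [MeasurableSpace Ω] (P : Measure Ω) (Y : Ω → ℝ) : ℝ≥0∞ :=
  sInf {s : ℝ≥0∞ | ∃ t : ℝ, 0 < t ∧
    ∫⁻ ω, ENNReal.ofReal (Real.exp (Y ω ^ 2 / t ^ 2)) ∂P ≤ 2 ∧ s = ENNReal.ofReal t}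

/-- `X` is a mean-zero, `K`-subgaussian random vector in `ℝ^p`:
`‖⟨X, x⟩‖_{ψ₂} ≤ K (E ⟨X, x⟩²)^{1/2}` for all `x`. The right-hand side is a finite real number, so
the condition forces all `⟨X, x⟩` to have finite moments of every order; in particular the
integrals below are never integrals of non-integrable functions. -/
structure IsSubgaussianVector {Ω : Type*} [MeasurableSpace Ω] {p : ℕ} (K : ℝ)
    (X : Ω → Fin p → ℝ) (P : Measure Ω) : Prop where
  aemeasurable : AEMeasurable X P
  mean_zero : ∀ i, ∫ ω, X ω i ∂P = 0
  psi2Norm_le : ∀ x : Fin p → ℝ, psi2Norm P (fun ω => X ω ⬝ᵥ x) ≤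
    ENNReal.ofReal (K * Real.sqrt (∫ ω, (X ω ⬝ᵥ x) ^ 2 ∂P))

/-- The covariance matrix `E (X Xᵀ)` of a mean-zero random vector. -/
noncomputable def covMatrix {Ω : Type*} [MeasurableSpace Ω] {p : ℕ}
    (X : Ω → Fin p → ℝ) (P : Measure Ω) : Matrix (Fin p) (Fin p) ℝ :=
  Matrix.of fun i j => ∫ ω, X ω i * X ω j ∂P

/-- The operator norm (largest singular value) of a square matrix, acting on Euclidean space. -/
noncomputable def opNorm {p : ℕ} (A : Matrix (Fin p) (Fin p) ℝ) : ℝ :=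
  ‖Matrix.toEuclideanCLM (n := Fin p) (𝕜 := ℝ) A‖

/-- The max norm `max_{i,j} |A_{ij}|`. -/
noncomputable def maxNorm {p : ℕ} (A : Matrix (Fin p) (Fin p) ℝ) : ℝ :=
  ⨆ i, ⨆ j, |A i j|

/-- The largest Euclidean norm of a column, `max_j (∑_i A_{ij}²)^{1/2}`. -/
noncomputable def maxColNorm {p : ℕ} (A : Matrix (Fin p) (Fin p) ℝ) : ℝ :=
  ⨆ j, Real.sqrt (∑ i, A i j ^ 2)

/-- The entrywise one-bit quantizer, with `sign 0 = 1`. -/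
noncomputable def signVec {p : ℕ} (x : Fin p → ℝ) : Fin p → ℝ :=
  fun i => if 0 ≤ x i then 1 else -1

/-- The asymmetric two-bit estimator
`(λ² / n) ∑_k sign(x^k + τ^k) sign(x^k + τ'^k)ᵀ`. -/
noncomputable def asymEstimator {n p : ℕ} (lam : ℝ) (x τ τ' : Fin n → Fin p → ℝ) :
    Matrix (Fin p) (Fin p) ℝ :=
  (lam ^ 2 / n) • ∑ k, Matrix.vecMulVec (signVec (x k + τ k)) (signVec (x k + τ' k))

/-- The symmetrized two-bit estimator. -/
noncomputable def dithEstimator {n p : ℕ} (lam : ℝ) (x τ τ' : Fin n → Fin p → ℝ) :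
    Matrix (Fin p) (Fin p) ℝ :=
  (1 / 2 : ℝ) • asymEstimator lam x τ τ' + (1 / 2 : ℝ) • (asymEstimator lam x τ τ')ᵀ

/-- The sampling model: `Xs 1, …, Xs n` are distributed as `X`, the dithers `τ k`, `τ' k` are
uniformly distributed in `[-λ, λ]^p`, and all these `3 n` random vectors are independent. -/
structure IsDitheredSample {Ω₀ Ω : Type*} [MeasurableSpace Ω₀] [MeasurableSpace Ω] {n p : ℕ}
    (X : Ω₀ → Fin p → ℝ) (P₀ : Measure Ω₀) (lam : ℝ)
    (Xs τ τ' : Fin n → Ω → Fin p → ℝ) (P : Measure Ω) : Prop where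
  identDistrib : ∀ k, IdentDistrib (Xs k) X P P₀
  uniform : ∀ k, pdf.IsUniform (τ k) (Set.Icc (fun _ => -lam) (fun _ => lam)) P
  uniform' : ∀ k, pdf.IsUniform (τ' k) (Set.Icc (fun _ => -lam) (fun _ => lam)) P
  indep : iIndepFun (Sum.elim Xs (Sum.elim τ τ')) P

/-- The random error `‖M ⊙ Σ̃ - M ⊙ S‖` of the masked symmetrized estimator. -/
noncomputable def maskedError {Ω : Type*} {n p : ℕ} (M S : Matrix (Fin p) (Fin p) ℝ) (lam : ℝ)
    (Xs τ τ' : Fin n → Ω → Fin p → ℝ) (ω : Ω) : ℝ :=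
  opNorm (M ⊙ dithEstimator lam (fun k => Xs k ω) (fun k => τ k ω) (fun k => τ' k ω) - M ⊙ S)

end DitheredCov

/-! Write `r` for the dithering range. Averaging `sign(x + τ)` over a uniform dither on `[-r, r]`
gives `clip (x / r)`, so, by independence of the two dithers, the estimator is unbiased for the
second moments of `X` clipped at level `r`. Once `r ^ 2` exceeds `4 K² log n ‖Σ‖_∞`, subgaussian
tails make the clipping error of every entry at most `4 r² / n` (`abs_clippedCov_sub_covMatrix_le`).
Since the mask is entrywise nonnegative, this costs at most `4 r² / n * ‖M‖` in operator norm
(`norm_le_norm_of_abs_le`).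

The fluctuation is an average of `n` independent symmetric matrices, each of norm at most `r² ‖M‖`.
The bound on their second moments, `posSemidef_smul_one_sub_integral_maskedSummand_sq`, is where
`‖M‖_{1→2}` enters: off the diagonal the conditional second moments of a dithered sign vector are
those of the clipped vector, and the diagonal correction is at most the identity. The matrix
Bernstein inequality `measureReal_norm_sum_sub_integral_gt_le` then gives the first estimate, and
the second follows from it deterministically.

Bernstein is proved by the Ahlswede–Winter argument: the Golden–Thompson inequality
`trace_exp_add_le` detaches one summand at a time from the trace exponential. Golden–Thompson comes
from the dyadic trace inequality `trace_mul_pow_two_pow_le` together with the Lie–Trotter formula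
`tendsto_exp_mul_exp_pow`. -/

namespace DitheredCov

/-! ### Trace inequalities for dyadic powers. -/

section TraceInequalities

variable {ι : Type*} [Fintype ι]

theorem trace_transpose_mul_self_nonneg (X : Matrix ι ι ℝ) : 0 ≤ (Xᵀ * X).trace := by
  rw [Matrix.trace]
  refine Finset.sum_nonneg fun i _ => ?_
  rw [Matrix.diag_apply, Matrix.mul_apply]
  exact Finset.sum_nonneg fun j _ => mul_self_nonneg _

/-- The arithmetic-geometric form of the Cauchy-Schwarz inequality for the Frobenius product. -/
theorem two_mul_trace_mul_le (X Y : Matrix ι ι ℝ) :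
    2 * (X * Y).trace ≤ (X * Xᵀ).trace + (Yᵀ * Y).trace := by
  have h := trace_transpose_mul_self_nonneg (Xᵀ - Y)
  rw [Matrix.transpose_sub, Matrix.transpose_transpose, Matrix.sub_mul, Matrix.mul_sub,
    Matrix.mul_sub, Matrix.trace_sub, Matrix.trace_sub, Matrix.trace_sub,
    ← Matrix.trace_transpose (Yᵀ * Xᵀ), Matrix.transpose_mul, Matrix.transpose_transpose,
    Matrix.transpose_transpose] at h
  linarith

variable [DecidableEq ι]

theorem trace_mul_pow_comm (X Y : Matrix ι ι ℝ) (n : ℕ) :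
    ((X * Y) ^ n).trace = ((Y * X) ^ n).trace := by
  rcases n with _ | n
  · simp
  · rw [pow_succ, ← mul_assoc, mul_pow_mul, pow_succ, Matrix.mul_assoc, Matrix.trace_mul_comm X,
      Matrix.mul_assoc]

/-- The two claims are proved together because each of them at `k + 1` uses both at `k`. For the
first, pass from `X` to `X * X`, rearrange cyclically into `(X * Xᵀ) * (Xᵀ * X)`, split by the
second claim and finish by Cauchy–Schwarz. For the second, apply the first claim to `A * B`,
rearrange into `(A * A) * (B * B)`, and split. -/
theorem trace_pow_two_pow_le_aux (k : ℕ) :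
    (∀ X : Matrix ι ι ℝ, (X ^ 2 ^ (k + 1)).trace ≤ ((X * Xᵀ) ^ 2 ^ k).trace) ∧
    (∀ A B : Matrix ι ι ℝ, A.IsSymm → B.IsSymm →
      ((A * B) ^ 2 ^ k).trace ≤ (A ^ 2 ^ k * B ^ 2 ^ k).trace) := by
  induction k with
  | zero =>
    refine ⟨fun X => ?_, fun A B _ _ => by simp⟩
    have h := two_mul_trace_mul_le X X
    rw [Matrix.trace_mul_comm Xᵀ X] at h
    simp only [zero_add, pow_one, pow_zero, sq]
    linarith
  | succ k ih =>
    have sq_pow : ∀ (Z : Matrix ι ι ℝ) (m : ℕ), Z ^ 2 ^ (m + 1) = (Z * Z) ^ 2 ^ m := fun Z m => by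
      rw [pow_succ', pow_mul, sq]
    constructor
    · intro X
      calc (X ^ 2 ^ (k + 1 + 1)).trace
          = ((X * X) ^ 2 ^ (k + 1)).trace := by rw [sq_pow]
        _ ≤ (((X * X) * (X * X)ᵀ) ^ 2 ^ k).trace := ih.1 _
        _ = (((X * Xᵀ) * (Xᵀ * X)) ^ 2 ^ k).trace := by
          rw [Matrix.transpose_mul, trace_mul_pow_comm (X * Xᵀ)]
          rw [← Matrix.mul_assoc, trace_mul_pow_comm _ Xᵀ]
          simp only [Matrix.mul_assoc]
        _ ≤ ((X * Xᵀ) ^ 2 ^ k * (Xᵀ * X) ^ 2 ^ k).trace :=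
          ih.2 _ _ (Matrix.isSymm_mul_transpose_self X) (Matrix.isSymm_transpose_mul_self X)
        _ ≤ ((X * Xᵀ) ^ 2 ^ (k + 1)).trace := by
          have h := two_mul_trace_mul_le ((X * Xᵀ) ^ 2 ^ k) ((Xᵀ * X) ^ 2 ^ k)
          rw [((Matrix.isSymm_mul_transpose_self X).pow _).eq,
            ((Matrix.isSymm_transpose_mul_self X).pow _).eq, ← pow_add, ← pow_add,
            trace_mul_pow_comm Xᵀ X] at h
          rw [pow_succ 2 k, mul_two]
          linarith
    · intro A B hA hB
      calc ((A * B) ^ 2 ^ (k + 1)).trace ≤ (((A * B) * (A * B)ᵀ) ^ 2 ^ k).trace := ih.1 _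
        _ = (((A * A) * (B * B)) ^ 2 ^ k).trace := by
          rw [Matrix.transpose_mul, hA.eq, hB.eq, ← Matrix.mul_assoc, trace_mul_pow_comm _ A]
          simp only [Matrix.mul_assoc]
        _ ≤ ((A * A) ^ 2 ^ k * (B * B) ^ 2 ^ k).trace :=
          ih.2 _ _ (by rw [← sq]; exact hA.pow 2) (by rw [← sq]; exact hB.pow 2)
        _ = (A ^ 2 ^ (k + 1) * B ^ 2 ^ (k + 1)).trace := by rw [sq_pow, sq_pow]

/-- The Araki-Lieb-Thirring inequality for symmetric matrices and dyadic exponents. -/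
theorem trace_mul_pow_two_pow_le {A B : Matrix ι ι ℝ} (hA : A.IsSymm) (hB : B.IsSymm) (k : ℕ) :
    ((A * B) ^ 2 ^ k).trace ≤ (A ^ 2 ^ k * B ^ 2 ^ k).trace :=
  (trace_pow_two_pow_le_aux k).2 A B hA hB

end TraceInequalities

/-! ### The Lie–Trotter product formula. -/

section LieTrotter

variable {𝔸 : Type*} [NormedRing 𝔸]

theorem norm_pow_sub_pow_le {a b : 𝔸} {M : ℝ} (hM : 1 ≤ M) (ha : ‖a‖ ≤ M) (hb : ‖b‖ ≤ M) (n : ℕ) :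
    ‖a ^ n - b ^ n‖ ≤ n * M ^ n * ‖a - b‖ := by
  have hM0 : 0 ≤ M := by linarith
  induction n with
  | zero => simp
  | succ n ih =>
    have hbn : ‖b ^ n * (a - b)‖ ≤ M ^ n * ‖a - b‖ := by
      rcases n with _ | n
      · simp
      · refine (norm_mul_le _ _).trans ?_
        gcongr
        exact (norm_pow_le' b n.succ_pos).trans (by gcongr)
    calc ‖a ^ (n + 1) - b ^ (n + 1)‖ = ‖(a ^ n - b ^ n) * a + b ^ n * (a - b)‖ := by
          congr 1; rw [pow_succ, pow_succ]; noncomm_ring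
      _ ≤ ‖a ^ n - b ^ n‖ * ‖a‖ + M ^ n * ‖a - b‖ :=
          (norm_add_le _ _).trans (add_le_add (norm_mul_le _ _) hbn)
      _ ≤ (n * M ^ n * ‖a - b‖) * M + M ^ (n + 1) * ‖a - b‖ := by
          gcongr
          exact n.le_succ
      _ = ((n + 1 : ℕ) : ℝ) * M ^ (n + 1) * ‖a - b‖ := by push_cast; ring

variable [NormedAlgebra ℝ 𝔸]

open NormedSpace Filter Topology

theorem norm_exp_le_exp_norm [NormOneClass 𝔸] (x : 𝔸) : ‖exp x‖ ≤ Real.exp ‖x‖ := by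
  rw [exp_eq_tsum (𝕂 := ℝ), Real.exp_eq_exp_ℝ, exp_eq_tsum (𝕂 := ℝ)]
  refine (norm_tsum_le_tsum_norm (norm_expSeries_summable' (𝕂 := ℝ) x)).trans ?_
  refine (norm_expSeries_summable' (𝕂 := ℝ) x).tsum_le_tsum (fun n => ?_)
    (expSeries_summable' (𝕂 := ℝ) ‖x‖)
  rw [norm_smul, Real.norm_of_nonneg (by positivity), smul_eq_mul]
  gcongr
  exact norm_pow_le x n

variable [CompleteSpace 𝔸]

/-- Both curves pass through `1` at `t = 0` with derivative `a + b`. -/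
theorem isLittleO_exp_smul_mul_exp_smul_sub (a b : 𝔸) :
    (fun t : ℝ => exp (t • a) * exp (t • b) - exp (t • (a + b))) =o[𝓝 0] fun t : ℝ => t := by
  have h := ((hasDerivAt_exp_smul_const (𝕂 := ℝ) a 0).mul
    (hasDerivAt_exp_smul_const (𝕂 := ℝ) b 0)).sub
    (hasDerivAt_exp_smul_const (𝕂 := ℝ) (a + b) 0)
  rw [hasDerivAt_iff_isLittleO_nhds_zero] at h
  simpa using h

/-- The Lie-Trotter product formula. -/
theorem tendsto_exp_mul_exp_pow [NormOneClass 𝔸] (a b : 𝔸) :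
    Tendsto (fun n : ℕ => (exp ((n : ℝ)⁻¹ • a) * exp ((n : ℝ)⁻¹ • b)) ^ n) atTop
      (𝓝 (exp (a + b))) := by
  rw [tendsto_iff_norm_sub_tendsto_zero]
  have hlim : Tendsto (fun n : ℕ => (n : ℝ)⁻¹) atTop (𝓝 0) := tendsto_inv_atTop_nhds_zero_nat
  have ho := ((isLittleO_exp_smul_mul_exp_smul_sub a b).comp_tendsto hlim).norm_left
  have h0 := (ho.tendsto_div_nhds_zero).const_mul (Real.exp (‖a‖ + ‖b‖))
  rw [mul_zero] at h0
  refine squeeze_zero' (.of_forall fun n => norm_nonneg _) ?_ h0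
  filter_upwards [eventually_gt_atTop 0] with n hn
  have hn' : (0 : ℝ) < n := by exact_mod_cast hn
  have hbound : ∀ x : 𝔸, ‖exp ((n : ℝ)⁻¹ • x)‖ ≤ Real.exp ((n : ℝ)⁻¹ * ‖x‖) := fun x => by
    refine (norm_exp_le_exp_norm _).trans_eq ?_
    rw [norm_smul, Real.norm_of_nonneg (by positivity)]
  have hP : exp (a + b) = exp ((n : ℝ)⁻¹ • (a + b)) ^ n := by
    let := NormedAlgebra.restrictScalars ℚ ℝ 𝔸
    rw [← exp_nsmul, ← Nat.cast_smul_eq_nsmul ℝ, smul_smul, mul_inv_cancel₀ hn'.ne', one_smul]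
  -- The `n`-th power of the common norm bound does not depend on `n`, so the telescoped error is
  -- `n` times a constant times `o(1 / n)`.
  have hM : Real.exp ((n : ℝ)⁻¹ * (‖a‖ + ‖b‖)) ^ n = Real.exp (‖a‖ + ‖b‖) := by
    rw [← Real.exp_nat_mul, ← mul_assoc, mul_inv_cancel₀ hn'.ne', one_mul]
  have key := norm_pow_sub_pow_le (a := exp ((n : ℝ)⁻¹ • a) * exp ((n : ℝ)⁻¹ • b))
    (b := exp ((n : ℝ)⁻¹ • (a + b))) (M := Real.exp ((n : ℝ)⁻¹ * (‖a‖ + ‖b‖)))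
    (Real.one_le_exp (by positivity))
    ((norm_mul_le _ _).trans (by
      rw [mul_add, Real.exp_add]
      exact mul_le_mul (hbound a) (hbound b) (norm_nonneg _) (Real.exp_nonneg _)))
    ((hbound _).trans (Real.exp_le_exp.2 (by gcongr; exact norm_add_le a b))) n
  rw [← hP, hM] at key
  refine key.trans_eq ?_
  simp only [Function.comp_apply]
  rw [div_inv_eq_mul]
  ring

end LieTrotter

/-! ### Golden–Thompson and spectral estimates for the matrix exponential. -/

section MatrixExponential

open NormedSpace Filter Topology
open scoped Matrix.Norms.L2Operator MatrixOrder

variable {ι : Type*} [Fintype ι] [DecidableEq ι]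

/-- The Golden-Thompson inequality. -/
theorem trace_exp_add_le {A B : Matrix ι ι ℝ} (hA : A.IsSymm) (hB : B.IsSymm) :
    (exp (A + B)).trace ≤ (exp A * exp B).trace := by
  rcases isEmpty_or_nonempty ι with hι | hι
  · simp [Matrix.trace]
  -- Only the subsequence `n = 2 ^ k` is used, because the trace inequality is available for dyadic
  -- exponents; along it the upper bound is constantly `tr (exp A * exp B)`.
  have hlim := (tendsto_exp_mul_exp_pow A B).comp
    (tendsto_pow_atTop_atTop_of_one_lt (one_lt_two : (1 : ℕ) < 2))
  have htr : Continuous fun X : Matrix ι ι ℝ => X.trace := continuous_id.matrix_trace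
  refine le_of_tendsto ((htr.tendsto _).comp hlim) (.of_forall fun k => ?_)
  have hpow : ∀ X : Matrix ι ι ℝ, exp (((2 ^ k : ℕ) : ℝ)⁻¹ • X) ^ 2 ^ k = exp X := fun X => by
    rw [← Matrix.exp_nsmul, ← Nat.cast_smul_eq_nsmul ℝ, smul_smul,
      mul_inv_cancel₀ (by positivity), one_smul]
  refine (trace_mul_pow_two_pow_le ?_ ?_ k).trans_eq ?_
  · exact (hA.smul _).exp
  · exact (hB.smul _).exp
  · simp only [hpow]

/-- The trace of a product of a positive semidefinite matrix with a matrix below `c • 1`. -/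
theorem trace_mul_le_mul_trace {P Q : Matrix ι ι ℝ} {c : ℝ} (hP : P.PosSemidef)
    (hQ : (c • (1 : Matrix ι ι ℝ) - Q).PosSemidef) : (P * Q).trace ≤ c * P.trace := by
  -- With `P = Rᴴ * R`, the claim is that `R * (c • 1 - Q) * Rᴴ` has nonnegative trace.
  obtain ⟨R, rfl⟩ := CStarAlgebra.nonneg_iff_eq_star_mul_self.mp hP.nonneg
  rw [Matrix.star_eq_conjTranspose]
  have h := (hQ.mul_mul_conjTranspose_same R).trace_nonneg
  rw [Matrix.mul_sub, Matrix.sub_mul, Matrix.trace_sub, Matrix.mul_smul, Matrix.smul_mul,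
    Matrix.trace_smul, Matrix.mul_one, Matrix.trace_mul_comm, ← Matrix.trace_mul_cycle,
    smul_eq_mul] at h
  rw [Matrix.trace_mul_comm, ← Matrix.mul_assoc]
  linarith

theorem posSemidef_exp {A : Matrix ι ι ℝ} (hA : A.IsHermitian) : (exp A).PosSemidef := by
  rw [← Matrix.nonneg_iff_posSemidef, ← CFC.real_exp_eq_normedSpace_exp hA.isSelfAdjoint]
  exact cfc_nonneg fun x _ => (Real.exp_nonneg x)

/-- The scalar inequality `exp x ≤ 1 + x + x ^ 2` on `[-1, 1]`, transferred by functional calculus.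
-/
theorem posSemidef_one_add_add_sq_sub_exp {A : Matrix ι ι ℝ} (hA : A.IsHermitian)
    (hnorm : ‖A‖ ≤ 1) : (1 + A + A ^ 2 - exp A).PosSemidef := by
  rcases isEmpty_or_nonempty ι with hι | hι
  · rw [← Matrix.nonneg_iff_posSemidef, Subsingleton.elim (1 + A + A ^ 2 - exp A) 0]
  have hsa := hA.isSelfAdjoint
  have h : 1 + A + A ^ 2 = cfc (fun x : ℝ => 1 + x + x ^ 2) A := by
    rw [cfc_add A (fun x : ℝ => 1 + x) (fun x : ℝ => x ^ 2), cfc_const_add 1 (fun x : ℝ => x) A,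
      cfc_id' ℝ A, cfc_pow_id A 2, map_one]
  rw [← Matrix.le_iff, h, ← CFC.real_exp_eq_normedSpace_exp hsa]
  refine cfc_mono fun x hx => ?_
  have hx1 : |x| ≤ 1 := (spectrum.norm_le_norm_of_mem hx).trans hnorm
  have := Real.abs_exp_sub_one_sub_id_le hx1
  linarith [le_abs_self (Real.exp x - 1 - x)]

theorem trace_cfc {A : Matrix ι ι ℝ} (hA : A.IsHermitian) (f : ℝ → ℝ) :
    (cfc f A).trace = ∑ i, f (hA.eigenvalues i) := by
  rw [hA.cfc_eq, Matrix.IsHermitian.cfc, Unitary.conjStarAlgAut_apply, Matrix.trace_mul_cycle,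
    Unitary.coe_star_mul_self]
  simp [Matrix.trace]

/-- The norm is `|μ|` for some eigenvalue `μ`, and `exp |μ|` is one of the positive terms in one of
the two traces. -/
theorem exp_norm_le_trace_exp_add_trace_exp_neg [Nonempty ι] {A : Matrix ι ι ℝ}
    (hA : A.IsHermitian) : Real.exp ‖A‖ ≤ (exp A).trace + (exp (-A)).trace := by
  have hsa := hA.isSelfAdjoint
  obtain ⟨x, hx, hxA⟩ := (IsometricContinuousFunctionalCalculus.isGreatest_norm_spectrum (𝕜 := ℝ) A).1
  have h : exp (-A) = cfc (fun x : ℝ => Real.exp (-x)) A := by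
    rw [← CFC.real_exp_eq_normedSpace_exp hsa.neg, cfc_comp_neg Real.exp A]
  rw [h, ← CFC.real_exp_eq_normedSpace_exp hsa, trace_cfc hA, trace_cfc hA,
    ← Finset.sum_add_distrib, ← hxA]
  rw [hA.spectrum_real_eq_range_eigenvalues] at hx
  obtain ⟨i, rfl⟩ := hx
  refine le_trans ?_ (Finset.single_le_sum (f := fun i => Real.exp (hA.eigenvalues i) +
    Real.exp (-hA.eigenvalues i)) (fun j _ => by positivity) (Finset.mem_univ i))
  simp only [Real.norm_eq_abs]
  rcases abs_choice (hA.eigenvalues i) with h | h <;> rw [h] <;>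
    linarith [Real.exp_pos (hA.eigenvalues i), Real.exp_pos (-hA.eigenvalues i)]

end MatrixExponential

/-! ### The matrix Bernstein inequality. -/

section RandomMatrices

open NormedSpace
open scoped Matrix.Norms.L2Operator

variable {Ω : Type*} [MeasurableSpace Ω] {P : Measure Ω}
  {ι : Type*} [Fintype ι] [DecidableEq ι]

theorem isSymm_of_isHermitian {n : Type*} {A : Matrix n n ℝ} (h : A.IsHermitian) : A.IsSymm :=
  (Matrix.conjTranspose_eq_transpose_of_trivial A).symm.trans h

theorem integral_linearMap_comp {X : Ω → Matrix ι ι ℝ} (hX : Integrable X P)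
    (f : Matrix ι ι ℝ →ₗ[ℝ] ℝ) : ∫ ω, f (X ω) ∂P = f (∫ ω, X ω ∂P) :=
  f.toContinuousLinearMap.integral_comp_comm hX

theorem integrable_linearMap_comp {X : Ω → Matrix ι ι ℝ} (hX : Integrable X P)
    (f : Matrix ι ι ℝ →ₗ[ℝ] ℝ) : Integrable (fun ω => f (X ω)) P :=
  f.toContinuousLinearMap.integrable_comp hX

theorem integral_matrix_apply {X : Ω → Matrix ι ι ℝ} (hX : Integrable X P) (i j : ι) :
    ∫ ω, X ω i j ∂P = (∫ ω, X ω ∂P) i j :=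
  integral_linearMap_comp hX (Matrix.entryLinearMap ℝ ℝ i j)

theorem integrable_matrix_apply {X : Ω → Matrix ι ι ℝ} (hX : Integrable X P) (i j : ι) :
    Integrable (fun ω => X ω i j) P :=
  integrable_linearMap_comp hX (Matrix.entryLinearMap ℝ ℝ i j)

theorem isHermitian_integral {X : Ω → Matrix ι ι ℝ} (hX : Integrable X P)
    (h : ∀ ω, (X ω).IsHermitian) : (∫ ω, X ω ∂P).IsHermitian := by
  refine Matrix.IsHermitian.ext fun i j => ?_
  rw [star_trivial, ← integral_matrix_apply hX, ← integral_matrix_apply hX]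
  exact integral_congr_ae (.of_forall fun ω => by simpa using (h ω).apply i j)

/-- The quadratic form of a matrix at a given vector, as a linear functional of the matrix. -/
noncomputable def quadFormLinearMap (x : ι → ℝ) : Matrix ι ι ℝ →ₗ[ℝ] ℝ where
  toFun A := x ⬝ᵥ A *ᵥ x
  map_add' A B := by rw [Matrix.add_mulVec, dotProduct_add]
  map_smul' c A := by rw [Matrix.smul_mulVec, dotProduct_smul, RingHom.id_apply]

theorem posSemidef_integral {X : Ω → Matrix ι ι ℝ} (hX : Integrable X P)
    (h : ∀ ω, (X ω).PosSemidef) : (∫ ω, X ω ∂P).PosSemidef := by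
  refine .of_dotProduct_mulVec_nonneg (isHermitian_integral hX fun ω => (h ω).1) fun x => ?_
  have := integral_linearMap_comp hX (quadFormLinearMap x)
  simp only [quadFormLinearMap, LinearMap.coe_mk, AddHom.coe_mk] at this
  rw [star_trivial, ← this]
  exact integral_nonneg fun ω => by simpa using (h ω).dotProduct_mulVec_nonneg x

variable [MeasurableSpace (Matrix ι ι ℝ)] [BorelSpace (Matrix ι ι ℝ)]

theorem integrable_of_norm_le [IsFiniteMeasure P] {X : Ω → Matrix ι ι ℝ} (hX : AEMeasurable X P)
    {R : ℝ} (hR : ∀ ω, ‖X ω‖ ≤ R) : Integrable X P :=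
  .of_bound hX.aestronglyMeasurable R (.of_forall hR)

theorem measurable_exp : Measurable (exp : Matrix ι ι ℝ → Matrix ι ι ℝ) := by
  let := NormedAlgebra.restrictScalars ℚ ℝ (Matrix ι ι ℝ)
  exact exp_continuous.measurable

theorem integrable_exp_of_norm_le [IsFiniteMeasure P] [Nonempty ι] {X : Ω → Matrix ι ι ℝ}
    (hX : AEMeasurable X P) {R : ℝ} (hR : ∀ ω, ‖X ω‖ ≤ R) :
    Integrable (fun ω => exp (X ω)) P :=
  integrable_of_norm_le (measurable_exp.comp_aemeasurable hX) fun ω =>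
    (norm_exp_le_exp_norm _).trans (Real.exp_le_exp.2 (hR ω))

theorem integral_trace_mul_of_indepFun {X Y : Ω → Matrix ι ι ℝ} (hX : Integrable X P)
    (hY : Integrable Y P) (hXY : IndepFun X Y P) :
    ∫ ω, (X ω * Y ω).trace ∂P = ∫ ω, (X ω * ∫ ω', Y ω' ∂P).trace ∂P := by
  have hm : ∀ i j, Measurable fun M : Matrix ι ι ℝ => M i j := fun i j =>
    (Matrix.entryLinearMap ℝ ℝ i j).toContinuousLinearMap.continuous.measurable
  have hind : ∀ i j k l, IndepFun (fun ω => X ω i j) (fun ω => Y ω k l) P := fun i j k l =>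
    hXY.comp (hm i j) (hm k l)
  simp only [Matrix.trace, Matrix.diag_apply, Matrix.mul_apply]
  have hXi := fun i j => integrable_matrix_apply hX i j
  have hYi := fun i j => integrable_matrix_apply hY i j
  have hi : ∀ i j k l, Integrable (fun ω => X ω i j * Y ω k l) P := fun i j k l =>
    (hind i j k l).integrable_mul (hXi i j) (hYi k l)
  rw [integral_finsetSum _ fun i _ => integrable_finsetSum _ fun j _ => hi _ _ _ _,
    integral_finsetSum _ fun i _ => integrable_finsetSum _ fun j _ => (hXi _ _).mul_const _]
  refine Finset.sum_congr rfl fun i _ => ?_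
  rw [integral_finsetSum _ fun j _ => hi _ _ _ _,
    integral_finsetSum _ fun j _ => (hXi _ _).mul_const _]
  refine Finset.sum_congr rfl fun j _ => ?_
  rw [integral_mul_const, ← integral_matrix_apply hY,
    (hind i j j i).integral_fun_mul_eq_mul_integral (hXi _ _).1 (hYi _ _).1]

variable {κ : Type*} [IsProbabilityMeasure P] [Nonempty ι]

/-- Golden–Thompson detaches one summand, independence replaces its exponential by the mean, and
that mean is at most `c • 1`; so each summand contributes one factor `c`, starting from `tr 1`. -/
theorem integral_trace_exp_sum_le {A : κ → Ω → Matrix ι ι ℝ} (hindep : iIndepFun A P)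
    (hmeas : ∀ k, AEMeasurable (A k) P) (hsymm : ∀ k ω, (A k ω).IsHermitian)
    {R : ℝ} (hR : ∀ k ω, ‖A k ω‖ ≤ R) {c : ℝ} (hc0 : 0 ≤ c)
    (hc : ∀ k, (c • (1 : Matrix ι ι ℝ) - ∫ ω, exp (A k ω) ∂P).PosSemidef) (s : Finset κ) :
    ∫ ω, (exp (∑ k ∈ s, A k ω)).trace ∂P ≤ c ^ s.card * Fintype.card ι := by
  classical
  induction s using Finset.induction_on with
  | empty => simp
  | insert k s hk ih =>
    have hSm : AEMeasurable (fun ω => ∑ j ∈ s, A j ω) P :=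
      Finset.aemeasurable_fun_sum s fun j _ => hmeas j
    have hSh : ∀ ω, (∑ j ∈ s, A j ω).IsHermitian := fun ω =>
      isSelfAdjoint_sum _ fun j _ => hsymm j ω
    have hSR : ∀ ω, ‖∑ j ∈ s, A j ω‖ ≤ s.card • R := fun ω =>
      (norm_sum_le_of_le s fun j _ => hR j ω).trans_eq (Finset.sum_const R)
    have hSint := integrable_exp_of_norm_le hSm hSR
    have hAint := integrable_exp_of_norm_le (hmeas k) (hR k)
    have hind : IndepFun (fun ω => exp (∑ j ∈ s, A j ω)) (fun ω => exp (A k ω)) P := by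
      have h := (hindep.indepFun_finsetSum_of_notMem₀ hmeas hk).comp measurable_exp measurable_exp
      convert h using 1
      · ext ω : 1
        simp
      · rfl
    have htr : ∀ Z : Matrix ι ι ℝ, Integrable (fun ω => (exp (∑ j ∈ s, A j ω) * Z).trace) P :=
      fun Z => integrable_linearMap_comp hSint
        (Matrix.traceLinearMap ι ℝ ℝ ∘ₗ LinearMap.mulRight ℝ Z)
    calc ∫ ω, (exp (∑ j ∈ insert k s, A j ω)).trace ∂P
        ≤ ∫ ω, (exp (∑ j ∈ s, A j ω) * exp (A k ω)).trace ∂P := by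
          refine integral_mono ?_ ?_ fun ω => ?_
          · exact integrable_linearMap_comp (integrable_exp_of_norm_le
              (Finset.aemeasurable_fun_sum (insert k s) fun j _ => hmeas j)
              (R := (insert k s).card • R)
              fun ω => (norm_sum_le_of_le _ fun j _ => hR j ω).trans_eq (Finset.sum_const R))
              (Matrix.traceLinearMap ι ℝ ℝ)
          · refine integrable_linearMap_comp (integrable_of_norm_le
              (R := Real.exp (s.card • R) * Real.exp R)
              ((measurable_exp.comp_aemeasurable hSm).mul
                (measurable_exp.comp_aemeasurable (hmeas k))) fun ω => ?_)
                (Matrix.traceLinearMap ι ℝ ℝ)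
            refine (norm_mul_le _ _).trans ?_
            gcongr
            · exact (norm_exp_le_exp_norm _).trans (Real.exp_le_exp.2 (hSR ω))
            · exact (norm_exp_le_exp_norm _).trans (Real.exp_le_exp.2 (hR k ω))
          · simp only
            rw [Finset.sum_insert hk, add_comm]
            exact trace_exp_add_le (isSymm_of_isHermitian (hSh ω)) (isSymm_of_isHermitian (hsymm k ω))
      _ = ∫ ω, (exp (∑ j ∈ s, A j ω) * ∫ ω', exp (A k ω') ∂P).trace ∂P :=
          integral_trace_mul_of_indepFun hSint hAint hind
      _ ≤ ∫ ω, c * (exp (∑ j ∈ s, A j ω)).trace ∂P := by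
          refine integral_mono (htr _) ?_ fun ω =>
            trace_mul_le_mul_trace (posSemidef_exp (hSh ω)) (hc k)
          simpa using (htr 1).const_mul c
      _ ≤ c * (c ^ s.card * Fintype.card ι) := by
          rw [integral_const_mul]
          gcongr
      _ = c ^ (insert k s).card * Fintype.card ι := by
          rw [Finset.card_insert_of_notMem hk]; ring

/-- Integrating `exp A ≤ 1 + A + A ^ 2` removes the linear term and leaves `1 + v ≤ exp v`. -/
theorem posSemidef_smul_one_sub_integral_exp {A : Ω → Matrix ι ι ℝ} (hmeas : AEMeasurable A P)
    (hsymm : ∀ ω, (A ω).IsHermitian) (hmean : ∫ ω, A ω ∂P = 0) {v : ℝ}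
    (hv : (v • (1 : Matrix ι ι ℝ) - ∫ ω, A ω ^ 2 ∂P).PosSemidef) (hnorm : ∀ ω, ‖A ω‖ ≤ 1) :
    (Real.exp v • (1 : Matrix ι ι ℝ) - ∫ ω, exp (A ω) ∂P).PosSemidef := by
  have hA : Integrable A P := integrable_of_norm_le hmeas hnorm
  have hA2 : Integrable (fun ω => A ω ^ 2) P :=
    integrable_of_norm_le (hmeas.pow_const 2) (R := 1) fun ω =>
      (norm_pow_le _ 2).trans (pow_le_one₀ (norm_nonneg _) (hnorm ω))
  have hexp := integrable_exp_of_norm_le hmeas hnorm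
  have h1A : Integrable (fun ω => 1 + A ω) P := (integrable_const _).add hA
  have h1AA : Integrable (fun ω => 1 + A ω + A ω ^ 2) P := h1A.add hA2
  have h1 := posSemidef_integral (X := fun ω => 1 + A ω + A ω ^ 2 - exp (A ω)) (h1AA.sub hexp)
    fun ω => posSemidef_one_add_add_sq_sub_exp (hsymm ω) (hnorm ω)
  have h2 : ∫ ω, (1 + A ω + A ω ^ 2 - exp (A ω)) ∂P
      = 1 + ∫ ω, A ω ^ 2 ∂P - ∫ ω, exp (A ω) ∂P := by
    rw [integral_sub h1AA hexp, integral_add h1A hA2, integral_add (integrable_const _) hA, hmean]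
    simp
  rw [h2] at h1
  have h3 : ((Real.exp v - 1 - v) • (1 : Matrix ι ι ℝ)).PosSemidef :=
    Matrix.PosSemidef.one.smul (by linarith [Real.add_one_le_exp v])
  convert (h1.add hv).add h3 using 1
  module

theorem integral_trace_exp_smul_sum_le [Fintype κ] {A : κ → Ω → Matrix ι ι ℝ}
    (hindep : iIndepFun A P) (hmeas : ∀ k, AEMeasurable (A k) P)
    (hsymm : ∀ k ω, (A k ω).IsHermitian) {R : ℝ} (hR : ∀ k ω, ‖A k ω‖ ≤ R)
    (hmean : ∀ k, ∫ ω, A k ω ∂P = 0) {v : ℝ}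
    (hv : ∀ k, (v • (1 : Matrix ι ι ℝ) - ∫ ω, A k ω ^ 2 ∂P).PosSemidef)
    {θ : ℝ} (hθ : |θ| * R ≤ 1) :
    ∫ ω, (exp (θ • ∑ k, A k ω)).trace ∂P ≤
      Fintype.card ι * Real.exp (Fintype.card κ * (θ ^ 2 * v)) := by
  have hnorm : ∀ k ω, ‖θ • A k ω‖ ≤ 1 := fun k ω => by
    rw [norm_smul, Real.norm_eq_abs]
    exact (mul_le_mul_of_nonneg_left (hR k ω) (abs_nonneg θ)).trans hθ
  have hmeas' : ∀ k, AEMeasurable (fun ω => θ • A k ω) P := fun k => (hmeas k).const_smul θ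
  have hsymm' : ∀ k ω, (θ • A k ω).IsHermitian := fun k ω =>
    (hsymm k ω).smul (IsSelfAdjoint.all θ)
  have hbound := integral_trace_exp_sum_le (A := fun k ω => θ • A k ω)
    (hindep.comp (fun _ M => θ • M) fun _ => measurable_const_smul θ) hmeas' hsymm' hnorm
    (Real.exp_nonneg (θ ^ 2 * v)) (fun k =>
      posSemidef_smul_one_sub_integral_exp (hmeas' k) (hsymm' k)
        (by rw [integral_smul, hmean, smul_zero]) (by
          simp only [smul_pow]
          rw [integral_smul, mul_smul, ← smul_sub]
          exact (hv k).smul (sq_nonneg θ)) (hnorm k)) Finset.univ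
  simp only [← Finset.smul_sum] at hbound
  refine hbound.trans_eq ?_
  rw [Real.exp_nat_mul, Finset.card_univ, mul_comm]

/-- The matrix Laplace transform method. -/
theorem measureReal_norm_sum_gt_le [Fintype κ] {A : κ → Ω → Matrix ι ι ℝ}
    (hindep : iIndepFun A P) (hmeas : ∀ k, AEMeasurable (A k) P)
    (hsymm : ∀ k ω, (A k ω).IsHermitian) {R : ℝ} (hR : ∀ k ω, ‖A k ω‖ ≤ R)
    (hmean : ∀ k, ∫ ω, A k ω ∂P = 0) {v : ℝ}
    (hv : ∀ k, (v • (1 : Matrix ι ι ℝ) - ∫ ω, A k ω ^ 2 ∂P).PosSemidef)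
    {θ : ℝ} (hθ0 : 0 ≤ θ) (hθ : θ * R ≤ 1) (s : ℝ) :
    P.real {ω | s < ‖∑ k, A k ω‖} ≤
      2 * Fintype.card ι * Real.exp (Fintype.card κ * (θ ^ 2 * v) - θ * s) := by
  have hSh : ∀ (a : ℝ) ω, (a • ∑ k, A k ω).IsHermitian := fun a ω =>
    Matrix.IsHermitian.smul (isSelfAdjoint_sum _ fun j _ => hsymm j ω) (IsSelfAdjoint.all a)
  have hint : ∀ a : ℝ, Integrable (fun ω => (exp (a • ∑ k, A k ω)).trace) P := fun a => by
    have hm : AEMeasurable (fun ω => ∑ k, A k ω) P :=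
      Finset.aemeasurable_fun_sum _ fun j _ => hmeas j
    have hm' : AEMeasurable (fun ω => a • ∑ k, A k ω) P := hm.const_smul a
    refine integrable_linearMap_comp (integrable_exp_of_norm_le hm'
      (R := |a| * (Fintype.card κ • R)) fun ω => ?_) (Matrix.traceLinearMap ι ℝ ℝ)
    rw [norm_smul, Real.norm_eq_abs]
    gcongr
    exact (norm_sum_le_of_le _ fun j _ => hR j ω).trans_eq (Finset.sum_const R)
  have h1 := integral_trace_exp_smul_sum_le hindep hmeas hsymm hR hmean hv
    (θ := θ) (by rwa [abs_of_nonneg hθ0])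
  -- The norm sees both ends of the spectrum, so the sign `-θ` is needed too; this produces the
  -- factor `2` in the tail.
  have h2 := integral_trace_exp_smul_sum_le hindep hmeas hsymm hR hmean hv
    (θ := -θ) (by rwa [abs_neg, abs_of_nonneg hθ0])
  rw [neg_sq] at h2
  have hmarkov := mul_meas_ge_le_integral_of_nonneg (μ := P)
    (f := fun ω => (exp (θ • ∑ k, A k ω)).trace + (exp (-θ • ∑ k, A k ω)).trace)
    (.of_forall fun ω => add_nonneg (posSemidef_exp (hSh θ ω)).trace_nonneg
      (posSemidef_exp (hSh (-θ) ω)).trace_nonneg) ((hint θ).add (hint (-θ))) (Real.exp (θ * s))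
  rw [integral_add (hint θ) (hint (-θ))] at hmarkov
  have hsub : P.real {ω | s < ‖∑ k, A k ω‖} ≤ P.real {ω | Real.exp (θ * s) ≤
      (exp (θ • ∑ k, A k ω)).trace + (exp (-θ • ∑ k, A k ω)).trace} := by
    refine measureReal_mono fun ω (hω : s < _) => ?_
    have h := exp_norm_le_trace_exp_add_trace_exp_neg (hSh θ ω)
    rw [norm_smul, Real.norm_of_nonneg hθ0, ← neg_smul] at h
    exact (Real.exp_le_exp.2 (mul_le_mul_of_nonneg_left hω.le hθ0)).trans h
  rw [Real.exp_sub, ← mul_div_assoc, le_div_iff₀ (Real.exp_pos _), mul_comm]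
  calc _ ≤ _ := mul_le_mul_of_nonneg_left hsub (Real.exp_nonneg _)
    _ ≤ _ := hmarkov
    _ ≤ _ := add_le_add h1 h2
    _ = _ := by ring

/-- The balancing choice is `θ = √(u / (N v))`, which makes `N θ² v = u`. If it violates `θ * R ≤
1`, the endpoint `θ = R⁻¹` works, because then `N v ≤ R² u`. -/
theorem exists_bernstein_exponent {N v R u : ℝ} (hR : 0 < R)
    (hu : 0 ≤ u) : ∃ θ : ℝ, 0 ≤ θ ∧ θ * R ≤ 1 ∧
      N * (θ ^ 2 * v) - θ * (2 * √(N * v * u) + 2 * R * u) ≤ -u := by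
  have hs := Real.sqrt_nonneg (N * v * u)
  rcases le_or_gt (N * v) (R ^ 2 * u) with h | h
  · refine ⟨R⁻¹, by positivity, by field_simp; exact le_rfl, ?_⟩
    have h1 : N * (R⁻¹ ^ 2 * v) ≤ u := by
      have : N * (R⁻¹ ^ 2 * v) = N * v / R ^ 2 := by field_simp
      rw [this, div_le_iff₀ (by positivity)]
      linarith
    have h2 : R⁻¹ * (2 * √(N * v * u) + 2 * R * u) = R⁻¹ * (2 * √(N * v * u)) + 2 * u := by
      field_simp
    have h3 : 0 ≤ R⁻¹ * (2 * √(N * v * u)) := by positivity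
    linarith
  · have hNv : 0 < N * v := lt_of_le_of_lt (by positivity) h
    refine ⟨√(u / (N * v)), Real.sqrt_nonneg _, ?_, ?_⟩
    · rw [show √(u / (N * v)) * R = √(u / (N * v)) * √(R ^ 2) by rw [Real.sqrt_sq hR.le],
        ← Real.sqrt_mul (by positivity), Real.sqrt_le_one, div_mul_eq_mul_div, div_le_one hNv]
      linarith
    · have h1 : N * (√(u / (N * v)) ^ 2 * v) = u := by
        rw [Real.sq_sqrt (by positivity), mul_comm, mul_assoc, mul_comm v, div_mul_cancel₀ _ hNv.ne']
      have h2 : √(u / (N * v)) * √(N * v * u) = u := by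
        rw [← Real.sqrt_mul (by positivity), ← mul_assoc, div_mul_cancel₀ _ hNv.ne', Real.sqrt_mul_self hu]
      have h3 : 0 ≤ √(u / (N * v)) * (2 * R * u) := by positivity
      linarith

/-- The matrix Bernstein inequality for bounded independent random symmetric matrices. -/
theorem measureReal_norm_sum_sub_integral_gt_le [Fintype κ] {B : κ → Ω → Matrix ι ι ℝ}
    (hindep : iIndepFun B P) (hmeas : ∀ k, AEMeasurable (B k) P)
    (hsymm : ∀ k ω, (B k ω).IsHermitian) {R : ℝ} (hR0 : 0 < R) (hR : ∀ k ω, ‖B k ω‖ ≤ R)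
    {v : ℝ}
    (hv : ∀ k, (v • (1 : Matrix ι ι ℝ) - ∫ ω, B k ω ^ 2 ∂P).PosSemidef)
    {u : ℝ} (hu : 0 ≤ u) :
    P.real {ω | 2 * √(Fintype.card κ * v * u) + 4 * R * u <
      ‖∑ k, (B k ω - ∫ ω', B k ω' ∂P)‖} ≤ 2 * Fintype.card ι * Real.exp (-u) := by
  have hB : ∀ k, Integrable (B k) P := fun k => integrable_of_norm_le (hmeas k) (hR k)
  have hB2 : ∀ k, Integrable (fun ω => B k ω ^ 2) P := fun k =>
    integrable_of_norm_le ((hmeas k).pow_const 2) (R := R ^ 2) fun ω =>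
      (norm_pow_le _ 2).trans (by gcongr; exact hR k ω)
  have hEsymm : ∀ k, (∫ ω, B k ω ∂P).IsHermitian := fun k => isHermitian_integral (hB k) (hsymm k)
  have hER : ∀ k, ‖∫ ω, B k ω ∂P‖ ≤ R := fun k => by
    simpa using norm_integral_le_of_norm_le_const (μ := P) (.of_forall (hR k))
  -- Centering at most doubles the norm bound, hence `2 * R` here and `4 * R * u` in the result.
  obtain ⟨θ, hθ0, hθ, hle⟩ := exists_bernstein_exponent (N := Fintype.card κ) (v := v)
    (R := 2 * R) (u := u) (by positivity) hu
  have h := measureReal_norm_sum_gt_le (A := fun k ω => B k ω - ∫ ω', B k ω' ∂P) (P := P)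
    (hindep.comp (fun k M => M - ∫ ω', B k ω' ∂P) fun k => measurable_id.sub_const _)
    (fun k => (hmeas k).sub_const _) (fun k ω => (hsymm k ω).sub (hEsymm k)) (R := 2 * R)
    (fun k ω => by linarith [norm_sub_le (B k ω) (∫ ω', B k ω' ∂P), hR k ω, hER k])
    (fun k => by rw [integral_sub (hB k) (integrable_const _)]; simp) (v := v)
    (fun k => by
      -- Centering lowers the second moment by the positive semidefinite matrix `(E B)²`, so a bound
      -- on the uncentered second moment suffices.
      have hE : ∫ ω, (B k ω - ∫ ω', B k ω' ∂P) ^ 2 ∂P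
          = ∫ ω, B k ω ^ 2 ∂P - (∫ ω, B k ω ∂P) * ∫ ω, B k ω ∂P := by
        set E := ∫ ω, B k ω ∂P with hE
        have h1 : ∀ ω, (B k ω - E) ^ 2 = B k ω ^ 2 - (B k ω * E + E * B k ω) + E * E := fun ω => by
          noncomm_ring
        have h2 : Integrable (fun ω => B k ω * E) P := (hB k).mul_const E
        have h3 : Integrable (fun ω => E * B k ω) P := (hB k).const_mul E
        have h23 : Integrable (fun ω => B k ω * E + E * B k ω) P := h2.add h3
        have h4 : Integrable (fun ω => B k ω ^ 2 - (B k ω * E + E * B k ω)) P := (hB2 k).sub h23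
        simp only [h1]
        rw [integral_add h4 (integrable_const _), integral_sub (hB2 k) h23, integral_add h2 h3, integral_mul_const_of_integrable,
          integral_const_mul_of_integrable, ← hE]
        · simp
          abel
        · exact hB k
        · exact hB k
      rw [hE, sub_sub_eq_add_sub, add_sub_right_comm]
      refine (hv k).add ?_
      have := Matrix.posSemidef_conjTranspose_mul_self (∫ ω, B k ω ∂P)
      rwa [(hEsymm k).eq] at this) hθ0 hθ (2 * √(Fintype.card κ * v * u) + 2 * (2 * R) * u)
  have h4 : 2 * (2 * R) * u = 4 * R * u := by ring
  rw [h4] at h hle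
  refine h.trans ?_
  gcongr

end RandomMatrices

/-! ### Comparison of matrix norms. -/

section OperatorNorm

open scoped Matrix.Norms.L2Operator

variable {ι : Type*} [Fintype ι]

theorem norm_toLp_sq (x : ι → ℝ) : ‖WithLp.toLp 2 x‖ ^ 2 = x ⬝ᵥ x := by
  rw [EuclideanSpace.real_norm_sq_eq]
  simp [dotProduct, sq]

variable [DecidableEq ι]

theorem mulVec_dotProduct_mulVec_le (A : Matrix ι ι ℝ) (x : ι → ℝ) :
    A *ᵥ x ⬝ᵥ A *ᵥ x ≤ ‖A‖ ^ 2 * (x ⬝ᵥ x) := by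
  rw [← norm_toLp_sq, ← norm_toLp_sq, ← mul_pow]
  exact pow_le_pow_left₀ (norm_nonneg _) (A.l2_opNorm_mulVec (WithLp.toLp 2 x)) 2

theorem dotProduct_mulVec_le (A : Matrix ι ι ℝ) (x : ι → ℝ) :
    x ⬝ᵥ A *ᵥ x ≤ ‖A‖ * (x ⬝ᵥ x) := by
  have h := Matrix.inner_toEuclideanCLM A (WithLp.toLp 2 x) (WithLp.toLp 2 x)
  simp only at h
  rw [← h, ← norm_toLp_sq, sq, ← mul_assoc, mul_comm]
  refine (real_inner_le_norm _ _).trans ?_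
  gcongr
  exact A.l2_opNorm_mulVec (WithLp.toLp 2 x)

theorem norm_le_of_mulVec_dotProduct_le (A : Matrix ι ι ℝ) {c : ℝ} (hc : 0 ≤ c)
    (h : ∀ x : ι → ℝ, A *ᵥ x ⬝ᵥ A *ᵥ x ≤ c ^ 2 * (x ⬝ᵥ x)) : ‖A‖ ≤ c := by
  rw [Matrix.cstar_norm_def]
  refine ContinuousLinearMap.opNorm_le_bound _ hc fun x => ?_
  refine le_of_sq_le_sq ?_ (by positivity)
  have := h x.ofLp
  rw [← norm_toLp_sq, ← norm_toLp_sq, ← mul_pow] at this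
  exact this

/-- Entrywise `|A x| ≤ B |x|`, and `|x|` has the same Euclidean norm as `x`. With `B` a multiple of
the mask, this turns entrywise bounds into operator norm bounds. -/
theorem norm_le_norm_of_abs_le {A B : Matrix ι ι ℝ} (h : ∀ i j, |A i j| ≤ B i j) : ‖A‖ ≤ ‖B‖ := by
  refine norm_le_of_mulVec_dotProduct_le A (norm_nonneg B) fun x => ?_
  have habs : (fun i => |x i|) ⬝ᵥ (fun i => |x i|) = x ⬝ᵥ x := by
    simp [dotProduct]
  rw [← habs]
  refine le_trans ?_ (mulVec_dotProduct_mulVec_le B fun i => |x i|)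
  refine Finset.sum_le_sum fun i _ => ?_
  have hi : |(A *ᵥ x) i| ≤ (B *ᵥ fun i => |x i|) i := by
    refine (Finset.abs_sum_le_sum_abs _ _).trans (Finset.sum_le_sum fun j _ => ?_)
    rw [abs_mul]
    exact mul_le_mul_of_nonneg_right (h i j) (abs_nonneg _)
  rw [← abs_mul_abs_self]
  exact mul_self_le_mul_self (abs_nonneg _) hi

theorem opNorm_eq_norm {p : ℕ} (A : Matrix (Fin p) (Fin p) ℝ) : opNorm A = ‖A‖ := rfl

theorem maxColNorm_nonneg {p : ℕ} (A : Matrix (Fin p) (Fin p) ℝ) : 0 ≤ maxColNorm A :=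
  Real.iSup_nonneg fun _ => Real.sqrt_nonneg _

theorem sum_sq_le_maxColNorm_sq {p : ℕ} (A : Matrix (Fin p) (Fin p) ℝ) (j : Fin p) :
    ∑ i, A i j ^ 2 ≤ maxColNorm A ^ 2 := by
  refine (Real.sqrt_le_left (maxColNorm_nonneg A)).1 ?_
  exact le_ciSup (f := fun j => √(∑ i, A i j ^ 2)) (Set.finite_range _).bddAbove j

theorem maxNorm_nonneg {p : ℕ} (A : Matrix (Fin p) (Fin p) ℝ) : 0 ≤ maxNorm A :=
  Real.iSup_nonneg fun _ => Real.iSup_nonneg fun _ => abs_nonneg _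

theorem abs_apply_le_maxNorm {p : ℕ} (A : Matrix (Fin p) (Fin p) ℝ) (i j : Fin p) :
    |A i j| ≤ maxNorm A :=
  (le_ciSup (f := fun j => |A i j|) (Set.finite_range _).bddAbove j).trans
    (le_ciSup (f := fun i => ⨆ j, |A i j|) (Set.finite_range _).bddAbove i)

theorem abs_apply_le_norm (A : Matrix ι ι ℝ) (i j : ι) : |A i j| ≤ ‖A‖ := by
  have h := mulVec_dotProduct_mulVec_le A (Pi.single j 1)
  rw [Matrix.mulVec_single_one] at h
  have h1 : A i j ^ 2 ≤ ‖A‖ ^ 2 := by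
    refine le_trans ?_ (h.trans_eq (by simp))
    rw [sq]
    exact Finset.single_le_sum (f := fun i => A i j * A i j)
      (fun k _ => mul_self_nonneg (A k j)) (Finset.mem_univ i)
  exact abs_le_of_sq_le_sq h1 (norm_nonneg A)

theorem maxNorm_le_opNorm {p : ℕ} (A : Matrix (Fin p) (Fin p) ℝ) : maxNorm A ≤ opNorm A :=
  Real.iSup_le (fun i => Real.iSup_le (fun j => abs_apply_le_norm A i j) (norm_nonneg _))
    (norm_nonneg _)

end OperatorNorm

/-! ### Clipping error under a subgaussian tail. -/

section Clipping

/-- Clipping of a real number to the interval `[-1, 1]`. -/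
noncomputable def clip (a : ℝ) : ℝ := max (-1) (min 1 a)

theorem measurable_clip : Measurable clip := by unfold clip; fun_prop

theorem abs_clip_le_one (a : ℝ) : |clip a| ≤ 1 :=
  abs_le.2 ⟨le_max_left _ _, max_le (by norm_num) (min_le_left _ _)⟩

/-- Clipping multiplies a number by a factor in `[0, 1]`. -/
theorem abs_clip_mul_clip_sub_le_abs (a b : ℝ) : |clip a * clip b - a * b| ≤ |a * b| := by
  have key : ∀ a : ℝ, ∃ s : ℝ, 0 ≤ s ∧ s ≤ 1 ∧ clip a = s * a := fun a => by
    rcases le_or_gt |a| 1 with h | h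
    · refine ⟨1, zero_le_one, le_rfl, ?_⟩
      rw [clip, min_eq_right (abs_le.1 h).2, max_eq_right (abs_le.1 h).1, one_mul]
    · refine ⟨|a|⁻¹, by positivity, inv_le_one_of_one_le₀ h.le, ?_⟩
      rcases lt_abs.1 h with h' | h'
      · rw [clip, min_eq_left h'.le, max_eq_right (by norm_num), abs_of_pos (by linarith),
          inv_mul_cancel₀ (by linarith)]
      · rw [clip, min_eq_right (by linarith), max_eq_left (by linarith), abs_of_neg (by linarith)]
        have : a ≠ 0 := by linarith
        field_simp
  obtain ⟨s, hs0, hs1, hs⟩ := key a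
  obtain ⟨t, ht0, ht1, ht⟩ := key b
  have h1 : clip a * clip b - a * b = -(1 - s * t) * (a * b) := by rw [hs, ht]; ring
  have hst : s * t ≤ 1 := mul_le_one₀ hs1 ht0 ht1
  rw [h1, abs_mul, abs_neg, abs_of_nonneg (by linarith)]
  exact mul_le_of_le_one_left (abs_nonneg _) (by linarith [mul_nonneg hs0 ht0])

/-- The error vanishes unless `|a| > 1` or `|b| > 1`. For `|a| > 1`, `a² ≤ exp (a² - 1)` and `a² - 1
+ log n ≤ 2 a² log n`, the latter because `log n ≥ 1/2`; this gains the factor `1 / n`. -/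
theorem abs_clip_mul_clip_sub_le_exp {n : ℕ} (hn : 2 ≤ n) (a b : ℝ) :
    |clip a * clip b - a * b| ≤
      (n : ℝ)⁻¹ * (Real.exp (2 * Real.log n * a ^ 2) + Real.exp (2 * Real.log n * b ^ 2)) := by
  have hn0 : (0 : ℝ) < n := by positivity
  have hlog : 1 / 2 ≤ Real.log n := by
    have h1 : Real.log 2 ≤ Real.log n := Real.log_le_log (by norm_num) (by exact_mod_cast hn)
    linarith [Real.log_two_gt_d9]
  have key : ∀ a : ℝ, 1 < |a| → a ^ 2 ≤ (n : ℝ)⁻¹ * Real.exp (2 * Real.log n * a ^ 2) := fun a ha => by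
    have ha2 : 1 < a ^ 2 := by rw [← sq_abs]; nlinarith
    rw [inv_mul_eq_div, le_div_iff₀ hn0]
    calc a ^ 2 * n ≤ Real.exp (a ^ 2 - 1) * Real.exp (Real.log n) := by
          rw [Real.exp_log hn0]
          gcongr
          linarith [Real.add_one_le_exp (a ^ 2 - 1)]
      _ ≤ Real.exp (2 * Real.log n * a ^ 2) := by
          rw [← Real.exp_add]
          refine Real.exp_le_exp.2 ?_
          nlinarith
  have hexp : ∀ a : ℝ, 0 ≤ (n : ℝ)⁻¹ * Real.exp (2 * Real.log n * a ^ 2) := fun a => by positivity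
  rw [mul_add]
  rcases le_or_gt |a| 1 with ha | ha <;> rcases le_or_gt |b| 1 with hb | hb
  · have h : ∀ a : ℝ, |a| ≤ 1 → clip a = a := fun a h => by
      rw [clip, min_eq_right (abs_le.1 h).2, max_eq_right (abs_le.1 h).1]
    rw [h a ha, h b hb, sub_self, abs_zero]
    linarith [hexp a, hexp b]
  all_goals refine (abs_clip_mul_clip_sub_le_abs a b).trans ?_
  all_goals rw [abs_mul]
  · nlinarith [key b hb, hexp a, sq_abs b, abs_nonneg a]
  · nlinarith [key a ha, hexp b, sq_abs a, abs_nonneg b]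
  · nlinarith [key a ha, key b hb, sq_abs a, sq_abs b, sq_nonneg (|a| - |b|), abs_nonneg a]

variable {Ω : Type*} [MeasurableSpace Ω] {P : Measure Ω}

/-- The gap `r < s` avoids having to know that the infimum defining `psi2Norm` is attained. -/
theorem lintegral_exp_sq_div_sq_le_two {Y : Ω → ℝ} {r s : ℝ} (hs : 0 < s) (hrs : r < s)
    (hY : psi2Norm P Y ≤ ENNReal.ofReal r) :
    ∫⁻ ω, ENNReal.ofReal (Real.exp (Y ω ^ 2 / s ^ 2)) ∂P ≤ 2 := by
  have h : psi2Norm P Y < ENNReal.ofReal s := hY.trans_lt ((ENNReal.ofReal_lt_ofReal_iff hs).2 hrs)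
  obtain ⟨_, ⟨t, ht, hle, rfl⟩, hts⟩ := sInf_lt_iff.1 h
  have hts' : t < s := (ENNReal.ofReal_lt_ofReal_iff hs).1 hts
  refine (lintegral_mono fun ω => ENNReal.ofReal_le_ofReal (Real.exp_le_exp.2 ?_)).trans hle
  gcongr

theorem integrable_exp_of_lintegral_le_two {Y : Ω → ℝ} (hY : AEMeasurable Y P) {b : ℝ}
    (h : ∫⁻ ω, ENNReal.ofReal (Real.exp (b * Y ω ^ 2)) ∂P ≤ 2) :
    Integrable (fun ω => Real.exp (b * Y ω ^ 2)) P ∧ ∫ ω, Real.exp (b * Y ω ^ 2) ∂P ≤ 2 := by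
  have hm : AEStronglyMeasurable (fun ω => Real.exp (b * Y ω ^ 2)) P :=
    (Real.measurable_exp.comp_aemeasurable ((hY.pow_const 2).const_mul b)).aestronglyMeasurable
  refine ⟨⟨hm, ?_⟩, ?_⟩
  · rw [hasFiniteIntegral_iff_ofReal (.of_forall fun ω => (Real.exp_pos _).le)]
    exact h.trans_lt (by norm_num)
  · rw [integral_eq_lintegral_of_nonneg_ae (.of_forall fun ω => (Real.exp_pos _).le) hm]
    exact ENNReal.toReal_le_of_le_ofReal (by norm_num) (by simpa using h)

theorem integrable_mul_of_lintegral_exp_le_two {n : ℕ} (hn : 2 ≤ n) {Y Z : Ω → ℝ}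
    (hY : AEMeasurable Y P) (hZ : AEMeasurable Z P)
    (hY2 : ∫⁻ ω, ENNReal.ofReal (Real.exp (2 * Real.log n * Y ω ^ 2)) ∂P ≤ 2)
    (hZ2 : ∫⁻ ω, ENNReal.ofReal (Real.exp (2 * Real.log n * Z ω ^ 2)) ∂P ≤ 2) :
    Integrable (fun ω => Y ω * Z ω) P := by
  have hlog : 1 / 2 ≤ Real.log n := by
    have h1 : Real.log 2 ≤ Real.log n := Real.log_le_log (by norm_num) (by exact_mod_cast hn)
    linarith [Real.log_two_gt_d9]
  refine ((integrable_exp_of_lintegral_le_two hY hY2).1.add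
    (integrable_exp_of_lintegral_le_two hZ hZ2).1).mono' (hY.mul hZ).aestronglyMeasurable
    (.of_forall fun ω => ?_)
  rw [Real.norm_eq_abs, abs_mul, Pi.add_apply]
  have h1 := Real.add_one_le_exp (2 * Real.log n * Y ω ^ 2)
  have h2 := Real.add_one_le_exp (2 * Real.log n * Z ω ^ 2)
  nlinarith [sq_nonneg (|Y ω| - |Z ω|), sq_abs (Y ω), sq_abs (Z ω), sq_nonneg (Y ω),
    sq_nonneg (Z ω)]

theorem abs_integral_clip_mul_clip_sub_le [IsFiniteMeasure P] {n : ℕ} (hn : 2 ≤ n) {Y Z : Ω → ℝ}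
    (hY : AEMeasurable Y P) (hZ : AEMeasurable Z P)
    (hY2 : ∫⁻ ω, ENNReal.ofReal (Real.exp (2 * Real.log n * Y ω ^ 2)) ∂P ≤ 2)
    (hZ2 : ∫⁻ ω, ENNReal.ofReal (Real.exp (2 * Real.log n * Z ω ^ 2)) ∂P ≤ 2) :
    |∫ ω, clip (Y ω) * clip (Z ω) ∂P - ∫ ω, Y ω * Z ω ∂P| ≤ 4 / n := by
  have hc : Integrable (fun ω => clip (Y ω) * clip (Z ω)) P := by
    refine .of_bound ((measurable_clip.comp_aemeasurable hY).mul
      (measurable_clip.comp_aemeasurable hZ)).aestronglyMeasurable 1 (.of_forall fun ω => ?_)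
    rw [Real.norm_eq_abs, abs_mul]
    exact mul_le_one₀ (abs_clip_le_one _) (abs_nonneg _) (abs_clip_le_one _)
  obtain ⟨hYi, hYe⟩ := integrable_exp_of_lintegral_le_two hY hY2
  obtain ⟨hZi, hZe⟩ := integrable_exp_of_lintegral_le_two hZ hZ2
  rw [← integral_sub hc (integrable_mul_of_lintegral_exp_le_two hn hY hZ hY2 hZ2)]
  refine abs_integral_le_integral_abs.trans ?_
  refine (integral_mono_of_nonneg (.of_forall fun ω => abs_nonneg _) ((hYi.add hZi).const_mul _)
    (.of_forall fun ω => abs_clip_mul_clip_sub_le_exp hn (Y ω) (Z ω))).trans ?_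
  rw [integral_const_mul, integral_add' hYi hZi, inv_mul_eq_div]
  gcongr
  linarith

end Clipping

/-! ### Averages of signs over a uniform dither. -/

section Dithering

/-- The one-bit quantizer on the real line. -/
noncomputable def sgn (a : ℝ) : ℝ := if 0 ≤ a then 1 else -1

theorem signVec_apply {p : ℕ} (x : Fin p → ℝ) (i : Fin p) : signVec x i = sgn (x i) := rfl

theorem measurable_sgn : Measurable sgn :=
  Measurable.ite measurableSet_Ici measurable_const measurable_const

theorem measurable_signVec {p : ℕ} : Measurable (signVec : (Fin p → ℝ) → Fin p → ℝ) :=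
  measurable_pi_lambda _ fun i => measurable_sgn.comp (measurable_pi_apply i)

theorem abs_sgn (a : ℝ) : |sgn a| = 1 := by
  unfold sgn; split_ifs <;> simp

theorem sgn_mul_self (a : ℝ) : sgn a * sgn a = 1 := by
  unfold sgn; split_ifs <;> simp

/-- The uniform distribution on `[-r, r]`. -/
noncomputable def uniformIcc (r : ℝ) : Measure ℝ := cond volume (Set.Icc (-r) r)

variable {r : ℝ}

theorem isProbabilityMeasure_uniformIcc (hr : 0 < r) : IsProbabilityMeasure (uniformIcc r) :=
  cond_isProbabilityMeasure_of_finite (by simp [hr]) (by simp)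

/-- The dither linearizes the quantizer: the chance that `s ≥ -x` is affine in `x` on `[-r, r]` and
saturates outside. -/
theorem integral_sgn_add (hr : 0 < r) (x : ℝ) :
    ∫ s, sgn (x + s) ∂(uniformIcc r) = clip (x / r) := by
  have := isProbabilityMeasure_uniformIcc hr
  have h : ∀ s, sgn (x + s) = (Set.Ici (-x)).indicator (fun _ => 2) s - 1 := fun s => by
    unfold sgn
    by_cases hs : 0 ≤ x + s
    · rw [if_pos hs, Set.indicator_of_mem (Set.mem_Ici.2 (by linarith))]; norm_num
    · rw [if_neg hs, Set.indicator_of_notMem (fun h => hs (by linarith [Set.mem_Ici.1 h]))]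
      norm_num
  have hI : Set.Icc (-r) r ∩ Set.Ici (-x) = Set.Icc (max (-r) (-x)) r := by
    ext s; simp only [Set.mem_inter_iff, Set.mem_Icc, Set.mem_Ici, max_le_iff]; tauto
  have hreal : (uniformIcc r).real (Set.Ici (-x)) =
      (volume.real (Set.Icc (-r) r))⁻¹ * volume.real (Set.Icc (-r) r ∩ Set.Ici (-x)) := by
    rw [measureReal_def, uniformIcc, cond_apply measurableSet_Icc, ENNReal.toReal_mul,
      ENNReal.toReal_inv]
    rfl
  simp only [h]
  rw [integral_sub ((integrable_const _).indicator measurableSet_Ici) (integrable_const _),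
    integral_indicator_const _ measurableSet_Ici, hreal, hI, Real.volume_real_Icc, Real.volume_real_Icc, clip]
  simp only [integral_const, probReal_univ, smul_eq_mul, one_mul]
  rw [max_eq_left (show 0 ≤ r - -r by linarith), sub_neg_eq_add]
  rcases le_total x (-r) with h1 | h1
  · rw [max_eq_right (show -r ≤ -x by linarith), max_eq_right (show r - -x ≤ 0 by linarith),
      max_eq_left ((min_le_right _ _).trans (by rw [div_le_iff₀ hr]; linarith))]
    ring
  rcases le_total r x with h2 | h2
  · rw [max_eq_left (show -x ≤ -r by linarith), max_eq_left (show 0 ≤ r - -r by linarith),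
      min_eq_left (by rw [le_div_iff₀ hr]; linarith), max_eq_right (by norm_num)]
    field_simp
    ring
  · rw [max_eq_right (show -r ≤ -x by linarith), max_eq_left (show 0 ≤ r - -x by linarith),
      min_eq_right (by rw [div_le_iff₀ hr]; linarith),
      max_eq_right (by rw [le_div_iff₀ hr]; linarith)]
    field_simp
    ring

variable {p : ℕ}

/-- The uniform distribution on the cube `[-r, r]^p`. -/
noncomputable def uniformCube (p : ℕ) (r : ℝ) : Measure (Fin p → ℝ) :=
  Measure.pi fun _ => uniformIcc r

theorem isProbabilityMeasure_uniformCube (hr : 0 < r) :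
    IsProbabilityMeasure (uniformCube p r) := by
  have := isProbabilityMeasure_uniformIcc hr
  unfold uniformCube
  infer_instance

/-- The product form makes the coordinates of a dither independent. -/
theorem cond_volume_Icc_eq_uniformCube (hr : 0 < r) :
    cond volume (Set.Icc (fun _ : Fin p => -r) fun _ => r) = uniformCube p r := by
  have := isProbabilityMeasure_uniformIcc hr
  refine (Measure.pi_eq fun s hs => ?_).symm
  have hI : Set.Icc (fun _ : Fin p => -r) (fun _ => r) = Set.univ.pi fun _ => Set.Icc (-r) r :=
    (Set.pi_univ_Icc _ _).symm
  rw [cond_apply measurableSet_Icc, hI, ← Set.pi_inter_distrib, volume_pi_pi, volume_pi_pi]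
  simp only [uniformIcc, cond_apply measurableSet_Icc]
  rw [Finset.prod_mul_distrib, ENNReal.prod_inv_distrib]
  intro i _ j _ _
  right
  simp

theorem integral_signVec_add_apply (hr : 0 < r) (x : Fin p → ℝ) (i : Fin p) :
    ∫ s, signVec (x + s) i ∂(uniformCube p r) = clip (x i / r) := by
  have := isProbabilityMeasure_uniformIcc hr
  rw [← integral_sgn_add hr]
  have h := (measurePreserving_eval (fun _ : Fin p => uniformIcc r) i)
  rw [← h.map_eq, integral_map h.measurable.aemeasurable]
  · rfl
  · exact (measurable_sgn.comp (measurable_const_add _)).aestronglyMeasurable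

theorem integral_signVec_add_mul_of_ne (hr : 0 < r) (x : Fin p → ℝ) {i j : Fin p} (hij : i ≠ j) :
    ∫ s, signVec (x + s) i * signVec (x + s) j ∂(uniformCube p r)
      = clip (x i / r) * clip (x j / r) := by
  have := isProbabilityMeasure_uniformIcc hr
  have hm : ∀ i, Measurable fun s : ℝ => sgn (x i + s) := fun i =>
    measurable_sgn.comp (measurable_const_add _)
  have h := (iIndepFun_pi (μ := fun _ : Fin p => uniformIcc r) (X := fun i s => sgn (x i + s))
    fun i => (hm i).aemeasurable).indepFun hij
  rw [← integral_signVec_add_apply hr, ← integral_signVec_add_apply hr]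
  exact h.integral_fun_mul_eq_mul_integral
    ((hm i).comp (measurable_pi_apply i)).aestronglyMeasurable
    ((hm j).comp (measurable_pi_apply j)).aestronglyMeasurable

/-- With `c i = clip (x i / r)`, the second moments of the sign vector are `c i * c j` off the
diagonal and `1` on it; the diagonal excess `1 - c i ^ 2` is at most `1`. -/
theorem integral_signVec_add_dotProduct_sq_le (hr : 0 < r) (x w : Fin p → ℝ) :
    ∫ s, (signVec (x + s) ⬝ᵥ w) ^ 2 ∂(uniformCube p r) ≤
      (∑ i, clip (x i / r) * w i) ^ 2 + w ⬝ᵥ w := by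
  have := isProbabilityMeasure_uniformCube (p := p) hr
  have hexp : ∀ y : Fin p → ℝ, (∑ i, y i * w i) ^ 2 = ∑ i, ∑ j, y i * y j * (w i * w j) :=
    fun y => by
      rw [sq, Finset.sum_mul_sum]
      exact Finset.sum_congr rfl fun i _ => Finset.sum_congr rfl fun j _ => by ring
  have hm : ∀ i, Measurable fun s : Fin p → ℝ => signVec (x + s) i := fun i =>
    measurable_sgn.comp (measurable_const.add (measurable_pi_apply i))
  have hint : ∀ i j, Integrable (fun s => signVec (x + s) i * signVec (x + s) j)
      (uniformCube p r) := fun i j => by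
    refine .of_bound ((hm i).mul (hm j)).aestronglyMeasurable 1 (.of_forall fun s => ?_)
    rw [Real.norm_eq_abs, abs_mul, signVec_apply, signVec_apply, abs_sgn, abs_sgn, one_mul]
  have hE : ∀ i j, ∫ s, signVec (x + s) i * signVec (x + s) j ∂(uniformCube p r) =
      clip (x i / r) * clip (x j / r) + if i = j then 1 - clip (x i / r) ^ 2 else 0 := fun i j => by
    split_ifs with hij
    · subst hij
      simp only [signVec_apply, sgn_mul_self]
      simp
      ring
    · rw [integral_signVec_add_mul_of_ne hr x hij, add_zero]
  simp only [dotProduct, hexp]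
  rw [integral_finsetSum _ fun i _ => integrable_finsetSum _ fun j _ => (hint i j).mul_const _,
    ← Finset.sum_add_distrib]
  refine Finset.sum_le_sum fun i _ => ?_
  rw [integral_finsetSum _ fun j _ => (hint i j).mul_const _]
  simp only [integral_mul_const, hE, add_mul, Finset.sum_add_distrib, ite_mul, zero_mul]
  rw [Finset.sum_ite_eq Finset.univ i, if_pos (Finset.mem_univ i)]
  nlinarith [mul_nonneg (sq_nonneg (clip (x i / r))) (mul_self_nonneg (w i))]

end Dithering

/-! ### Conditioning on an independent variable. -/

section Fubini

variable {Ω E F : Type*} [MeasurableSpace Ω] [MeasurableSpace E] [MeasurableSpace F]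
  {P : Measure Ω} [IsProbabilityMeasure P]

/-- The law of total expectation for a bounded function of two independent random elements. -/
theorem integral_comp_of_indepFun {X : Ω → E} {T : Ω → F} (hX : AEMeasurable X P)
    (hT : AEMeasurable T P) (hXT : IndepFun X T P) {f : E → F → ℝ}
    (hf : Measurable (Function.uncurry f)) {C : ℝ} (hC : ∀ x t, |f x t| ≤ C) :
    ∫ ω, f (X ω) (T ω) ∂P = ∫ ω, ∫ t, f (X ω) t ∂(P.map T) ∂P := by
  have := Measure.isProbabilityMeasure_map hX
  have := Measure.isProbabilityMeasure_map hT
  have hlaw := (indepFun_iff_map_prod_eq_prod_map_map hX hT).1 hXT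
  calc ∫ ω, f (X ω) (T ω) ∂P
      = ∫ z, Function.uncurry f z ∂(P.map fun ω => (X ω, T ω)) :=
        (integral_map (hX.prodMk hT) hf.aestronglyMeasurable).symm
    _ = ∫ x, ∫ t, f x t ∂(P.map T) ∂(P.map X) := by
        rw [hlaw, integral_prod _ (.of_bound hf.aestronglyMeasurable C
          (.of_forall fun z => hC z.1 z.2))]
        rfl
    _ = ∫ ω, ∫ t, f (X ω) t ∂(P.map T) ∂P :=
        integral_map hX hf.stronglyMeasurable.integral_prod_right.aestronglyMeasurable

end Fubini

/-! ### Independence of the sample triples. -/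

section Grouping

variable {Ω κ : Type*} [MeasurableSpace Ω] {P : Measure Ω} [IsProbabilityMeasure P]

theorem iIndepFun_of_indepFun_finset {E : κ → Type*} [∀ k, MeasurableSpace (E k)]
    {T : (k : κ) → Ω → E k}
    (h : ∀ (s : Finset κ) (k : κ), k ∉ s → IndepFun (fun ω (j : s) => T j ω) (T k) P) :
    iIndepFun T P := by
  classical
  rw [iIndepFun_iff_measure_inter_preimage_eq_mul]
  intro s
  induction s using Finset.induction_on with
  | empty => simp
  | insert k s hk ih =>
    intro A hA
    have hs : ⋂ i ∈ s, T i ⁻¹' A i =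
        (fun ω (j : s) => T j ω) ⁻¹' Set.univ.pi fun j : s => A j := by
      ext ω; simp
    rw [Finset.prod_insert hk, ← ih fun i hi => hA i (Finset.mem_insert_of_mem hi),
      Finset.set_biInter_insert, hs, Set.inter_comm, (h s k hk).measure_inter_preimage_eq_mul _ _
        (.univ_pi fun j => hA j (Finset.mem_insert_of_mem j.2)) (hA k (Finset.mem_insert_self k s)),
      mul_comm]

/-- Regroups the `3 n` independent vectors by sample, so that the summands of the estimator become
independent. -/
theorem iIndepFun_prodMk_of_sumElim {E : Type*} [MeasurableSpace E] {f g h : κ → Ω → E}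
    (hind : iIndepFun (Sum.elim f (Sum.elim g h)) P) (hf : ∀ k, AEMeasurable (f k) P)
    (hg : ∀ k, AEMeasurable (g k) P) (hh : ∀ k, AEMeasurable (h k) P) :
    iIndepFun (fun k ω => (f k ω, g k ω, h k ω)) P := by
  classical
  refine iIndepFun_of_indepFun_finset fun s k hk => ?_
  have hdisj : Disjoint (s.disjSum (s.disjSum s)) (({k} : Finset κ).disjSum
      (({k} : Finset κ).disjSum {k})) := by
    rw [Finset.disjoint_left]
    rintro (j | j | j) h1 h2 <;> simp at h1 h2 <;> exact hk (h2 ▸ h1)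
  have h1 := hind.indepFun_finset₀ _ _ hdisj (by rintro (j | j | j) <;> simp [hf, hg, hh])
  refine h1.comp (φ := fun v (j : s) => (v ⟨.inl j, by simp⟩, v ⟨.inr (.inl j), by simp⟩,
    v ⟨.inr (.inr j), by simp⟩)) (ψ := fun v => (v ⟨.inl k, by simp⟩, v ⟨.inr (.inl k), by simp⟩,
    v ⟨.inr (.inr k), by simp⟩)) ?_ ?_ <;> fun_prop

end Grouping

/-! ### The contribution of a single sample. -/

section Summand

open scoped Matrix.Norms.L2Operator

variable {p : ℕ}

/-- The contribution of one sample to `n` times the masked symmetrized estimator. -/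
noncomputable def maskedSummand (M : Matrix (Fin p) (Fin p) ℝ) (r : ℝ)
    (z : (Fin p → ℝ) × (Fin p → ℝ) × (Fin p → ℝ)) : Matrix (Fin p) (Fin p) ℝ :=
  Matrix.of fun i j => r ^ 2 / 2 * (M i j *
    (signVec (z.1 + z.2.1) i * signVec (z.1 + z.2.2) j +
      signVec (z.1 + z.2.2) i * signVec (z.1 + z.2.1) j))

variable {M : Matrix (Fin p) (Fin p) ℝ} {r : ℝ} (z : (Fin p → ℝ) × (Fin p → ℝ) × (Fin p → ℝ))

theorem isHermitian_maskedSummand (hM : M.IsSymm) : (maskedSummand M r z).IsHermitian := by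
  refine Matrix.IsHermitian.ext fun i j => ?_
  simp only [maskedSummand, Matrix.of_apply, star_trivial, hM.apply i j]
  ring

theorem norm_maskedSummand_le (hM : ∀ i j, 0 ≤ M i j) : ‖maskedSummand M r z‖ ≤ r ^ 2 * ‖M‖ := by
  rw [← Real.norm_of_nonneg (sq_nonneg r), ← norm_smul]
  refine norm_le_norm_of_abs_le fun i j => ?_
  have hs : ∀ (x : Fin p → ℝ) i, |signVec x i| = 1 := fun x i => abs_sgn _
  simp only [maskedSummand, Matrix.of_apply, Matrix.smul_apply, smul_eq_mul]
  rw [abs_mul, abs_mul, abs_of_nonneg (hM i j), abs_of_nonneg (by positivity)]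
  have h := abs_add_le (signVec (z.1 + z.2.1) i * signVec (z.1 + z.2.2) j)
    (signVec (z.1 + z.2.2) i * signVec (z.1 + z.2.1) j)
  rw [abs_mul, abs_mul, hs, hs, hs, hs] at h
  have h2 : r ^ 2 * M i j = r ^ 2 / 2 * (M i j * (1 * 1 + 1 * 1)) := by ring
  rw [h2]
  exact mul_le_mul_of_nonneg_left (mul_le_mul_of_nonneg_left h (hM i j)) (by positivity)

theorem measurable_maskedSummand_apply (i j : Fin p) :
    Measurable fun z => maskedSummand M r z i j := by
  have h1 : ∀ i, Measurable fun z : (Fin p → ℝ) × (Fin p → ℝ) × (Fin p → ℝ) =>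
      signVec (z.1 + z.2.1) i := fun i =>
    (measurable_pi_apply i).comp (measurable_signVec.comp (by fun_prop))
  have h2 : ∀ i, Measurable fun z : (Fin p → ℝ) × (Fin p → ℝ) × (Fin p → ℝ) =>
      signVec (z.1 + z.2.2) i := fun i =>
    (measurable_pi_apply i).comp (measurable_signVec.comp (by fun_prop))
  exact ((((h1 i).mul (h2 j)).add ((h2 i).mul (h1 j))).const_mul (M i j)).const_mul (r ^ 2 / 2)

theorem measurable_maskedSummand [MeasurableSpace (Matrix (Fin p) (Fin p) ℝ)]
    [BorelSpace (Matrix (Fin p) (Fin p) ℝ)] : Measurable (maskedSummand M r) :=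
  (Matrix.ofLinearEquiv (m := Fin p) (n := Fin p) (α := ℝ)
    ℝ).toLinearMap.continuous_of_finiteDimensional.measurable.comp
    (measurable_pi_lambda _ fun i => measurable_pi_lambda _ fun j =>
      measurable_maskedSummand_apply i j)

/-- The left side is `‖B x‖²`, whose `k`-th row pairs the masked vector `(M k i * x i)_i` with each
sign vector. Since signs square to `1`, `(a + b)² ≤ 2 (a² + b²)` separates the two dithers. -/
theorem dotProduct_maskedSummand_sq_mulVec_le (hM : M.IsSymm) (x : Fin p → ℝ) :
    x ⬝ᵥ (maskedSummand M r z ^ 2) *ᵥ x ≤ r ^ 4 / 2 * ∑ k,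
      ((signVec (z.1 + z.2.1) ⬝ᵥ fun i => M k i * x i) ^ 2 +
        (signVec (z.1 + z.2.2) ⬝ᵥ fun i => M k i * x i) ^ 2) := by
  set Y := signVec (z.1 + z.2.1) with hY
  set Y' := signVec (z.1 + z.2.2) with hY'
  have hrow : ∀ k, (maskedSummand M r z *ᵥ x) k = r ^ 2 / 2 *
      (Y k * (Y' ⬝ᵥ fun i => M k i * x i) + Y' k * (Y ⬝ᵥ fun i => M k i * x i)) := fun k => by
    simp only [Matrix.mulVec, dotProduct, maskedSummand, Matrix.of_apply, ← hY, ← hY',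
      Finset.mul_sum, ← Finset.sum_add_distrib]
    exact Finset.sum_congr rfl fun i _ => by ring
  rw [sq, ← Matrix.mulVec_mulVec, Matrix.dotProduct_mulVec, ← Matrix.mulVec_transpose,
    (isSymm_of_isHermitian (isHermitian_maskedSummand z hM)).eq, dotProduct, Finset.mul_sum]
  refine Finset.sum_le_sum fun k _ => ?_
  rw [hrow]
  set a := Y' ⬝ᵥ fun i => M k i * x i
  set b := Y ⬝ᵥ fun i => M k i * x i
  have h1 : Y k * Y k = 1 := sgn_mul_self _
  have h2 : Y' k * Y' k = 1 := sgn_mul_self _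
  have h3 : (Y k * a + Y' k * b) * (Y k * a + Y' k * b) ≤ 2 * (b ^ 2 + a ^ 2) := by
    have h4 : (Y k * a + Y' k * b) * (Y k * a + Y' k * b) + (Y k * a - Y' k * b) ^ 2 =
        2 * ((Y k * Y k) * a ^ 2 + (Y' k * Y' k) * b ^ 2) := by ring
    rw [h1, h2] at h4
    linarith [sq_nonneg (Y k * a - Y' k * b)]
  calc _ = r ^ 4 / 4 * ((Y k * a + Y' k * b) * (Y k * a + Y' k * b)) := by ring
    _ ≤ r ^ 4 / 4 * (2 * (b ^ 2 + a ^ 2)) := by gcongr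
    _ = _ := by ring

end Summand

/-! ### Mean and second moment of a summand. -/

section Moments

open scoped Matrix.Norms.L2Operator

variable {Ω : Type*} [MeasurableSpace Ω] {P : Measure Ω} {p : ℕ} {r : ℝ}
  {X τ τ' : Ω → Fin p → ℝ}

/-- The second moment matrix of the clipped vector `max (-r) (min r X)`. -/
noncomputable def clippedCov (r : ℝ) (X : Ω → Fin p → ℝ) (P : Measure Ω) :
    Matrix (Fin p) (Fin p) ℝ :=
  Matrix.of fun i j => r ^ 2 * ∫ ω, clip (X ω i / r) * clip (X ω j / r) ∂P

theorem aemeasurable_clip_div (hX : AEMeasurable X P) (i : Fin p) :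
    AEMeasurable (fun ω => clip (X ω i / r)) P :=
  measurable_clip.comp_aemeasurable (((measurable_pi_apply i).comp_aemeasurable hX).div_const r)

variable [IsProbabilityMeasure P]

theorem integrable_clip_div_mul (hX : AEMeasurable X P) (i j : Fin p) :
    Integrable (fun ω => clip (X ω i / r) * clip (X ω j / r)) P := by
  refine .of_bound ((aemeasurable_clip_div hX i).mul
    (aemeasurable_clip_div hX j)).aestronglyMeasurable 1 (.of_forall fun ω => ?_)
  rw [Real.norm_eq_abs, abs_mul]
  exact mul_le_one₀ (abs_clip_le_one _) (abs_nonneg _) (abs_clip_le_one _)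

theorem integrable_signVec_dotProduct_sq (hX : AEMeasurable X P) (hτ : AEMeasurable τ P)
    (w : Fin p → ℝ) : Integrable (fun ω => (signVec (X ω + τ ω) ⬝ᵥ w) ^ 2) P := by
  have hm : Measurable fun y : Fin p → ℝ => (signVec y ⬝ᵥ w) ^ 2 :=
    (Finset.measurable_fun_sum _ fun i _ =>
      ((measurable_pi_apply i).comp measurable_signVec).mul_const _).pow_const 2
  refine .of_bound (hm.comp_aemeasurable (hX.add hτ)).aestronglyMeasurable ((∑ i, |w i|) ^ 2)
    (.of_forall fun ω => ?_)
  rw [norm_pow, Real.norm_eq_abs]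
  gcongr
  refine (Finset.abs_sum_le_sum_abs _ _).trans_eq (Finset.sum_congr rfl fun i _ => ?_)
  rw [abs_mul, signVec_apply, abs_sgn, one_mul]

/-- Conditioning on `X` leaves the quadratic form of the clipped covariance plus the diagonal excess
`r² (w ⬝ᵥ w)`. Replacing the clipped covariance by `S` costs `β` per entry. -/
theorem integral_signVec_dotProduct_sq_le (hr : 0 < r) (hX : AEMeasurable X P)
    (hτ : AEMeasurable τ P) (hlaw : P.map τ = uniformCube p r) (hind : IndepFun X τ P)
    {S : Matrix (Fin p) (Fin p) ℝ} {β : ℝ} (hβ : ∀ i j, |clippedCov r X P i j - S i j| ≤ β)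
    (w : Fin p → ℝ) :
    r ^ 2 * ∫ ω, (signVec (X ω + τ ω) ⬝ᵥ w) ^ 2 ∂P ≤
      ‖S‖ * (w ⬝ᵥ w) + β * (∑ i, |w i|) ^ 2 + r ^ 2 * (w ⬝ᵥ w) := by
  have hexp : ∀ y : Fin p → ℝ, (∑ i, y i * w i) ^ 2 = ∑ i, ∑ j, y i * y j * (w i * w j) :=
    fun y => by
      rw [sq, Finset.sum_mul_sum]
      exact Finset.sum_congr rfl fun i _ => Finset.sum_congr rfl fun j _ => by ring
  have hm : Measurable (Function.uncurry fun x s : Fin p → ℝ => (signVec (x + s) ⬝ᵥ w) ^ 2) :=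
    (Finset.measurable_fun_sum _ fun i _ => ((measurable_pi_apply i).comp
      (measurable_signVec.comp (measurable_fst.add measurable_snd))).mul_const _).pow_const 2
  have hb : ∀ x s : Fin p → ℝ, |(signVec (x + s) ⬝ᵥ w) ^ 2| ≤ (∑ i, |w i|) ^ 2 := fun x s => by
    rw [abs_pow]
    gcongr
    refine (Finset.abs_sum_le_sum_abs _ _).trans_eq (Finset.sum_congr rfl fun i _ => ?_)
    rw [abs_mul, signVec_apply, abs_sgn, one_mul]
  have hcl : Integrable (fun ω => (∑ i, clip (X ω i / r) * w i) ^ 2) P := by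
    simp only [hexp]
    exact integrable_finsetSum _ fun i _ => integrable_finsetSum _ fun j _ =>
      (integrable_clip_div_mul hX i j).mul_const _
  have h1 : ∫ ω, (signVec (X ω + τ ω) ⬝ᵥ w) ^ 2 ∂P ≤
      ∫ ω, (∑ i, clip (X ω i / r) * w i) ^ 2 ∂P + w ⬝ᵥ w := by
    rw [integral_comp_of_indepFun hX hτ hind hm hb, hlaw]
    refine (integral_mono_of_nonneg (.of_forall fun ω => integral_nonneg fun s => sq_nonneg _)
      (hcl.add (integrable_const (w ⬝ᵥ w)))
      (.of_forall fun ω => integral_signVec_add_dotProduct_sq_le hr (X ω) w)).trans_eq ?_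
    rw [integral_add' hcl (integrable_const _)]
    simp
  have h2 : r ^ 2 * ∫ ω, (∑ i, clip (X ω i / r) * w i) ^ 2 ∂P =
      ∑ i, ∑ j, clippedCov r X P i j * (w i * w j) := by
    simp only [hexp]
    rw [integral_finsetSum _ fun i _ => integrable_finsetSum _ fun j _ =>
      (integrable_clip_div_mul hX i j).mul_const _, Finset.mul_sum]
    refine Finset.sum_congr rfl fun i _ => ?_
    rw [integral_finsetSum _ fun j _ => (integrable_clip_div_mul hX i j).mul_const _,
      Finset.mul_sum]
    refine Finset.sum_congr rfl fun j _ => ?_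
    rw [integral_mul_const, clippedCov, Matrix.of_apply, mul_assoc]
  have h3 : ∑ i, ∑ j, clippedCov r X P i j * (w i * w j) ≤
      w ⬝ᵥ S *ᵥ w + β * (∑ i, |w i|) ^ 2 := by
    rw [sq (∑ i, |w i|), Finset.sum_mul_sum]
    simp only [dotProduct, Matrix.mulVec, Finset.mul_sum, ← Finset.sum_add_distrib]
    refine Finset.sum_le_sum fun i _ => Finset.sum_le_sum fun j _ => ?_
    have h4 : (clippedCov r X P i j - S i j) * (w i * w j) ≤ β * (|w i| * |w j|) := by
      refine (le_abs_self _).trans ?_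
      rw [abs_mul, abs_mul]
      exact mul_le_mul_of_nonneg_right (hβ i j) (by positivity)
    linarith
  have h5 := mul_le_mul_of_nonneg_left h1 (sq_nonneg r)
  have h6 := dotProduct_mulVec_le S w
  linarith

/-- Given `X`, the two dithers are independent, so the mean of the product of signs factors even for
`i = j`; a single dither would give the constant `1` there. -/
theorem integral_maskedSummand_apply (hr : 0 < r) (hX : AEMeasurable X P)
    (hτ : AEMeasurable τ P) (hτ' : AEMeasurable τ' P) (hlaw : P.map τ = uniformCube p r)
    (hlaw' : P.map τ' = uniformCube p r) (hττ' : IndepFun τ τ' P)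
    (hind : IndepFun X (fun ω => (τ ω, τ' ω)) P) (M : Matrix (Fin p) (Fin p) ℝ) (i j : Fin p) :
    ∫ ω, maskedSummand M r (X ω, τ ω, τ' ω) i j ∂P = M i j * clippedCov r X P i j := by
  have := isProbabilityMeasure_uniformCube (p := p) hr
  have hlaw2 : P.map (fun ω => (τ ω, τ' ω)) = (uniformCube p r).prod (uniformCube p r) := by
    rw [(indepFun_iff_map_prod_eq_prod_map_map hτ hτ').1 hττ', hlaw, hlaw']
  have hm : ∀ i j, Measurable (Function.uncurry fun (x : Fin p → ℝ)
      (t : (Fin p → ℝ) × (Fin p → ℝ)) => signVec (x + t.1) i * signVec (x + t.2) j) := fun i j =>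
    ((measurable_pi_apply i).comp (measurable_signVec.comp (by fun_prop))).mul
      ((measurable_pi_apply j).comp (measurable_signVec.comp (by fun_prop)))
  have hb : ∀ i j (x : Fin p → ℝ) (t : (Fin p → ℝ) × (Fin p → ℝ)),
      |signVec (x + t.1) i * signVec (x + t.2) j| ≤ 1 := fun i j x t => by
    rw [abs_mul, signVec_apply, signVec_apply, abs_sgn, abs_sgn, one_mul]
  have hE : ∀ i j, ∫ ω, signVec (X ω + τ ω) i * signVec (X ω + τ' ω) j ∂P =
      ∫ ω, clip (X ω i / r) * clip (X ω j / r) ∂P := fun i j => by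
    rw [integral_comp_of_indepFun hX (hτ.prodMk hτ') hind (hm i j) (hb i j), hlaw2]
    refine integral_congr_ae (.of_forall fun ω => ?_)
    simp only
    rw [integral_prod_mul (fun s => signVec (X ω + s) i) fun s => signVec (X ω + s) j,
      integral_signVec_add_apply hr, integral_signVec_add_apply hr]
  have hi : ∀ i j, Integrable (fun ω => signVec (X ω + τ ω) i * signVec (X ω + τ' ω) j) P :=
    fun i j => .of_bound ((hm i j).comp_aemeasurable
      (hX.prodMk (hτ.prodMk hτ'))).aestronglyMeasurable 1 (.of_forall fun ω => hb i j _ (_, _))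
  simp only [maskedSummand, Matrix.of_apply, clippedCov]
  simp only [mul_comm (signVec (X _ + τ' _) i)]
  rw [integral_const_mul, integral_const_mul, integral_add (hi i j) (hi j i), hE, hE]
  simp only [mul_comm (clip (X _ j / r))]
  ring

/-- With `w k i = M k i * x i`, the Euclidean terms sum over `k` to at most `maxColNorm M ^ 2 *
‖x‖²`, while the bias terms `(∑ i, |w k i|)²` sum to `‖M |x|‖² ≤ ‖M‖² ‖x‖²`. -/
theorem posSemidef_smul_one_sub_integral_maskedSummand_sq [NeZero p] (hr : 0 < r)
    (hX : AEMeasurable X P) (hτ : AEMeasurable τ P) (hτ' : AEMeasurable τ' P)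
    (hlaw : P.map τ = uniformCube p r) (hlaw' : P.map τ' = uniformCube p r)
    (hind : IndepFun X τ P) (hind' : IndepFun X τ' P)
    {M : Matrix (Fin p) (Fin p) ℝ} (hM : M.IsSymm) (hM0 : ∀ i j, 0 ≤ M i j)
    {S : Matrix (Fin p) (Fin p) ℝ} {β : ℝ} (hβ0 : 0 ≤ β)
    (hβ : ∀ i j, |clippedCov r X P i j - S i j| ≤ β) :
    ((r ^ 2 * (maxColNorm M ^ 2 * (‖S‖ + r ^ 2) + β * ‖M‖ ^ 2)) •
      (1 : Matrix (Fin p) (Fin p) ℝ) -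
        ∫ ω, maskedSummand M r (X ω, τ ω, τ' ω) ^ 2 ∂P).PosSemidef := by
  let : MeasurableSpace (Matrix (Fin p) (Fin p) ℝ) := borel _
  have : BorelSpace (Matrix (Fin p) (Fin p) ℝ) := ⟨rfl⟩
  have hint : Integrable (fun ω => maskedSummand M r (X ω, τ ω, τ' ω) ^ 2) P :=
    integrable_of_norm_le ((measurable_maskedSummand.comp_aemeasurable
      (hX.prodMk (hτ.prodMk hτ'))).pow_const 2) (R := (r ^ 2 * ‖M‖) ^ 2) fun ω =>
      (norm_pow_le _ 2).trans (by gcongr; exact norm_maskedSummand_le _ hM0)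
  refine .of_dotProduct_mulVec_nonneg (Matrix.IsHermitian.sub
    (Matrix.isHermitian_one.smul (IsSelfAdjoint.all _)) (isHermitian_integral hint fun ω =>
      (isHermitian_maskedSummand _ hM).pow 2)) fun x => ?_
  have hq := integral_linearMap_comp hint (quadFormLinearMap x)
  simp only [quadFormLinearMap, LinearMap.coe_mk, AddHom.coe_mk] at hq
  rw [star_trivial, Matrix.sub_mulVec, dotProduct_sub, ← hq, Matrix.smul_mulVec, Matrix.one_mulVec,
    dotProduct_smul, smul_eq_mul, sub_nonneg]
  set w : Fin p → Fin p → ℝ := fun k i => M k i * x i with hw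
  have hi := fun k => integrable_signVec_dotProduct_sq hX hτ (w k)
  have hi' := fun k => integrable_signVec_dotProduct_sq hX hτ' (w k)
  have hii : ∀ k, Integrable (fun ω => (signVec (X ω + τ ω) ⬝ᵥ w k) ^ 2 +
      (signVec (X ω + τ' ω) ⬝ᵥ w k) ^ 2) P := fun k => (hi k).add (hi' k)
  have h1 : ∫ ω, x ⬝ᵥ (maskedSummand M r (X ω, τ ω, τ' ω) ^ 2) *ᵥ x ∂P ≤
      ∫ ω, r ^ 4 / 2 * ∑ k, ((signVec (X ω + τ ω) ⬝ᵥ w k) ^ 2 +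
        (signVec (X ω + τ' ω) ⬝ᵥ w k) ^ 2) ∂P :=
    integral_mono (integrable_linearMap_comp hint (quadFormLinearMap x))
      ((integrable_finsetSum _ fun k _ => hii k).const_mul _)
      fun ω => dotProduct_maskedSummand_sq_mulVec_le (X ω, τ ω, τ' ω) hM x
  rw [integral_const_mul, integral_finsetSum _ fun k _ => hii k] at h1
  refine h1.trans ?_
  have h2 : ∀ k, r ^ 2 * ∫ ω, ((signVec (X ω + τ ω) ⬝ᵥ w k) ^ 2 +
      (signVec (X ω + τ' ω) ⬝ᵥ w k) ^ 2) ∂P ≤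
      2 * ((‖S‖ + r ^ 2) * (w k ⬝ᵥ w k) + β * (∑ i, |w k i|) ^ 2) := fun k => by
    rw [integral_add (hi k) (hi' k)]
    have h3 := integral_signVec_dotProduct_sq_le hr hX hτ hlaw hind hβ (w k)
    have h4 := integral_signVec_dotProduct_sq_le hr hX hτ' hlaw' hind' hβ (w k)
    linarith
  have h5 : ∑ k, w k ⬝ᵥ w k ≤ maxColNorm M ^ 2 * (x ⬝ᵥ x) := by
    simp only [dotProduct, hw]
    rw [Finset.sum_comm, Finset.mul_sum]
    refine Finset.sum_le_sum fun i _ => ?_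
    rw [show ∑ k, M k i * x i * (M k i * x i) = (∑ k, M k i ^ 2) * (x i * x i) by
      rw [Finset.sum_mul]; exact Finset.sum_congr rfl fun k _ => by ring]
    exact mul_le_mul_of_nonneg_right (sum_sq_le_maxColNorm_sq M i) (mul_self_nonneg _)
  have h6 : ∑ k, (∑ i, |w k i|) ^ 2 ≤ ‖M‖ ^ 2 * (x ⬝ᵥ x) := by
    have h := mulVec_dotProduct_mulVec_le M fun i => |x i|
    have habs : (fun i => |x i|) ⬝ᵥ (fun i => |x i|) = x ⬝ᵥ x := by simp [dotProduct]
    rw [habs] at h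
    refine le_of_eq_of_le (Finset.sum_congr rfl fun k _ => ?_) h
    simp only [Matrix.mulVec, dotProduct, hw, abs_mul, abs_of_nonneg (hM0 _ _), sq]
  have h7 : ∑ k, r ^ 2 * ∫ ω, ((signVec (X ω + τ ω) ⬝ᵥ w k) ^ 2 +
      (signVec (X ω + τ' ω) ⬝ᵥ w k) ^ 2) ∂P ≤ 2 * ((‖S‖ + r ^ 2) *
        (maxColNorm M ^ 2 * (x ⬝ᵥ x)) + β * (‖M‖ ^ 2 * (x ⬝ᵥ x))) := by
    refine (Finset.sum_le_sum fun k _ => h2 k).trans ?_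
    rw [← Finset.mul_sum, Finset.sum_add_distrib, ← Finset.mul_sum, ← Finset.mul_sum]
    gcongr
  rw [← Finset.mul_sum] at h7
  have h8 := mul_le_mul_of_nonneg_left h7 (show 0 ≤ r ^ 2 / 2 by positivity)
  linarith

end Moments

/-! ### Simplification of the Bernstein bound. -/

/-- Here `m`, `s`, `R` stand for `‖M‖_{1→2}`, `‖Σ‖`, `‖M‖`, and `ℓ` for `log p + t`. Because `ℓ ≥
1/2`, the bias and its share of the variance are absorbed into the term linear in `ℓ / N`; the
contributions there are `8 + 8 + 8 = 24`. -/
theorem deviation_bound_le {N m s R r ℓ u : ℝ} (hN : 0 < N) (hm : 0 ≤ m) (hs : 0 ≤ s) (hR : 0 ≤ R)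
    (hr : 0 ≤ r) (hℓ : 1 / 2 ≤ ℓ) (hu0 : 0 ≤ u) (hu : u ≤ 2 * ℓ) :
    N⁻¹ * (2 * √(N * (r ^ 2 * (m ^ 2 * (s + r ^ 2) + 4 * r ^ 2 / N * R ^ 2)) * u) +
      4 * (r ^ 2 * R) * u) + 4 * r ^ 2 / N * R ≤
    24 * (m * (r * √s + r ^ 2) * √(ℓ / N) + r ^ 2 * R * (ℓ / N)) := by
  set q := √(ℓ / N) with hq
  have hq0 : 0 ≤ q := Real.sqrt_nonneg _
  have hq2 : N * q ^ 2 = ℓ := by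
    rw [hq, Real.sq_sqrt (by positivity)]; field_simp
  have hsq : √s ^ 2 = s := Real.sq_sqrt hs
  have hsqrt : √(N * (r ^ 2 * (m ^ 2 * (s + r ^ 2) + 4 * r ^ 2 / N * R ^ 2)) * u) ≤
      2 * (N * (m * (r * √s + r ^ 2) * q)) + 4 * r ^ 2 * R * ℓ := by
    refine Real.sqrt_le_iff.2 ⟨by positivity, ?_⟩
    have h1 : N * (r ^ 2 * (m ^ 2 * (s + r ^ 2) + 4 * r ^ 2 / N * R ^ 2)) * u =
        (N * (r ^ 2 * m ^ 2 * (s + r ^ 2)) + 4 * r ^ 4 * R ^ 2) * u := by field_simp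
    have h2 : s + r ^ 2 ≤ (√s + r) ^ 2 := by nlinarith [mul_nonneg (Real.sqrt_nonneg s) hr]
    have h3 : (N * (r ^ 2 * m ^ 2 * (s + r ^ 2)) + 4 * r ^ 4 * R ^ 2) * u ≤
        (N * (r ^ 2 * m ^ 2 * (√s + r) ^ 2) + 4 * r ^ 4 * R ^ 2) * (2 * ℓ) := by gcongr
    have h4 : N * (r ^ 2 * m ^ 2 * (√s + r) ^ 2) * (2 * ℓ) =
        2 * (N * (m * (r * √s + r ^ 2) * q)) ^ 2 := by
      rw [← hq2]; ring
    have h5 : 4 * r ^ 4 * R ^ 2 * (2 * ℓ) ≤ (4 * r ^ 2 * R * ℓ) ^ 2 := by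
      have : (4 * r ^ 2 * R * ℓ) ^ 2 - 4 * r ^ 4 * R ^ 2 * (2 * ℓ) =
        8 * (r ^ 4 * R ^ 2 * ℓ) * (2 * ℓ - 1) := by ring
      have h6 : 0 ≤ 8 * (r ^ 4 * R ^ 2 * ℓ) * (2 * ℓ - 1) :=
        mul_nonneg (by positivity) (by linarith)
      linarith
    have h7 : 0 ≤ N * (m * (r * √s + r ^ 2) * q) := by positivity
    have h8 : 0 ≤ 4 * r ^ 2 * R * ℓ := by positivity
    rw [h1]
    nlinarith [mul_nonneg h7 h8]
  have h9 : 4 * (r ^ 2 * R) * u ≤ 4 * (r ^ 2 * R) * (2 * ℓ) := by gcongr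
  have h10 : 4 * r ^ 2 / N * R ≤ N⁻¹ * (8 * (r ^ 2 * R) * ℓ) := by
    rw [inv_mul_eq_div, div_mul_eq_mul_div]
    gcongr ?_ / N
    nlinarith [mul_nonneg (sq_nonneg r) hR]
  calc _ ≤ N⁻¹ * (2 * (2 * (N * (m * (r * √s + r ^ 2) * q)) + 4 * r ^ 2 * R * ℓ) +
        4 * (r ^ 2 * R) * (2 * ℓ)) + N⁻¹ * (8 * (r ^ 2 * R) * ℓ) := by gcongr
    _ = 4 * (m * (r * √s + r ^ 2) * q) + 24 * (r ^ 2 * R * (ℓ / N)) := by field_simp; ring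
    _ ≤ _ := by
      have : 0 ≤ m * (r * √s + r ^ 2) * q := by positivity
      linarith

/-! ### Bias and deviation of the masked estimator. -/

section Deviation

open scoped Matrix.Norms.L2Operator

variable {Ω₀ Ω : Type*} [MeasurableSpace Ω₀] [MeasurableSpace Ω]
  {P₀ : Measure Ω₀} {P : Measure Ω} {n p : ℕ} {r : ℝ} {X : Ω₀ → Fin p → ℝ}
  {Xs τ τ' : Fin n → Ω → Fin p → ℝ}

theorem aemeasurable_of_isUniform_cube (hr : 0 < r) {T : Ω → Fin p → ℝ}
    (hT : pdf.IsUniform T (Set.Icc (fun _ => -r) (fun _ => r)) P) : AEMeasurable T P := by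
  refine hT.aemeasurable ?_ isCompact_Icc.measure_lt_top.ne
  rw [Real.volume_Icc_pi]
  simp only [ne_eq, Finset.prod_eq_zero_iff, not_exists, not_and, ENNReal.ofReal_eq_zero, not_le]
  intro i _
  linarith

theorem map_eq_uniformCube (hr : 0 < r) {T : Ω → Fin p → ℝ}
    (hT : pdf.IsUniform T (Set.Icc (fun _ => -r) (fun _ => r)) P) :
    P.map T = uniformCube p r :=
  Eq.trans hT (cond_volume_Icc_eq_uniformCube hr)

/-- The exponent `2 log n` needs the `ψ₂` norm of `X i` to be below `r / √(2 log n)`, that is `2 K²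
log n * Var < r²`. The constant `4 K²` leaves a factor `2` to spare, which makes the inequality
strict. -/
theorem lintegral_exp_le_two_of_isSubgaussianVector {K : ℝ} (hK : 0 < K) (hn : 2 ≤ n)
    (hX : IsSubgaussianVector K X P₀) (hr : 0 < r)
    (hc : 4 * K ^ 2 * (Real.log n * maxNorm (covMatrix X P₀)) ≤ r ^ 2) (i : Fin p) :
    ∫⁻ ω, ENNReal.ofReal (Real.exp (2 * Real.log n * (X ω i / r) ^ 2)) ∂P₀ ≤ 2 := by
  have hlog : 0 < Real.log n := Real.log_pos (by exact_mod_cast hn)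
  have h := hX.psi2Norm_le (Pi.single i 1)
  simp only [dotProduct_single, mul_one] at h
  have hs : 0 < r / √(2 * Real.log n) := by positivity
  have hvar : ∫ ω, X ω i ^ 2 ∂P₀ ≤ maxNorm (covMatrix X P₀) := by
    refine le_trans (le_of_eq ?_) ((le_abs_self _).trans (abs_apply_le_maxNorm _ i i))
    simp [covMatrix, sq]
  have hlt : K * √(∫ ω, X ω i ^ 2 ∂P₀) < r / √(2 * Real.log n) := by
    set V := ∫ ω, X ω i ^ 2 ∂P₀ with hV
    have hV0 : 0 ≤ V := integral_nonneg fun ω => sq_nonneg _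
    refine lt_of_pow_lt_pow_left₀ 2 hs.le ?_
    rw [mul_pow, div_pow, Real.sq_sqrt hV0, Real.sq_sqrt (by positivity),
      lt_div_iff₀ (by positivity)]
    have h1 : K ^ 2 * (Real.log n * V) ≤ K ^ 2 * (Real.log n * maxNorm (covMatrix X P₀)) := by
      gcongr
    have h2 : 0 ≤ K ^ 2 * (Real.log n * V) := by positivity
    nlinarith [pow_pos hr 2]
  refine le_trans (le_of_eq (lintegral_congr fun ω => ?_))
    (lintegral_exp_sq_div_sq_le_two hs hlt h)
  congr 2
  rw [div_pow, div_pow, Real.sq_sqrt (by positivity)]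
  field_simp

theorem clippedCov_congr {Y : Ω → Fin p → ℝ} (h : IdentDistrib Y X P P₀) :
    clippedCov r Y P = clippedCov r X P₀ := by
  ext i j
  have hm : ∀ i, Measurable fun x : Fin p → ℝ => clip (x i / r) := fun i =>
    measurable_clip.comp (g := clip) (by fun_prop : Measurable fun x : Fin p → ℝ => x i / r)
  simp only [clippedCov, Matrix.of_apply]
  congr 1
  exact (h.comp ((hm i).mul (hm j))).integral_eq

theorem hadamard_dithEstimator_eq (M : Matrix (Fin p) (Fin p) ℝ) (x s t : Fin n → Fin p → ℝ) :
    M ⊙ dithEstimator r x s t = (n : ℝ)⁻¹ • ∑ k, maskedSummand M r (x k, s k, t k) := by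
  ext i j
  simp only [dithEstimator, asymEstimator, Matrix.hadamard_apply, Matrix.add_apply,
    Matrix.smul_apply, Matrix.transpose_apply, Matrix.sum_apply, Matrix.vecMulVec_apply,
    maskedSummand, Matrix.of_apply, smul_eq_mul, ← Finset.mul_sum, Finset.sum_add_distrib]
  rw [Finset.sum_congr rfl fun k _ => mul_comm (signVec (x k + s k) j) (signVec (x k + t k) i)]
  ring

variable [IsProbabilityMeasure P₀]

theorem abs_clippedCov_sub_covMatrix_le (hn : 2 ≤ n) (hr : 0 < r) (hX : AEMeasurable X P₀)
    (h : ∀ i, ∫⁻ ω, ENNReal.ofReal (Real.exp (2 * Real.log n * (X ω i / r) ^ 2)) ∂P₀ ≤ 2)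
    (i j : Fin p) : |clippedCov r X P₀ i j - covMatrix X P₀ i j| ≤ 4 * r ^ 2 / n := by
  have hm : ∀ i, AEMeasurable (fun ω => X ω i / r) P₀ := fun i =>
    ((measurable_pi_apply i).comp_aemeasurable hX).div_const r
  have h1 := abs_integral_clip_mul_clip_sub_le hn (hm i) (hm j) (h i) (h j)
  have h2 : covMatrix X P₀ i j = r ^ 2 * ∫ ω, X ω i / r * (X ω j / r) ∂P₀ := by
    rw [← integral_const_mul, covMatrix, Matrix.of_apply]
    refine integral_congr_ae (.of_forall fun ω => ?_)
    simp only
    field_simp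
  rw [h2, clippedCov, Matrix.of_apply, ← mul_sub, abs_mul, abs_of_nonneg (sq_nonneg r)]
  exact (mul_le_mul_of_nonneg_left h1 (sq_nonneg r)).trans_eq (by ring)

variable [IsProbabilityMeasure P]

/-- The masked estimator concentrates around its expectation, the masked covariance matrix of the
clipped vector. -/
theorem measureReal_maskedError_gt_le [NeZero p] (hn : 2 ≤ n) (hr : 0 < r)
    (hX : AEMeasurable X P₀)
    (hexp : ∀ i, ∫⁻ ω, ENNReal.ofReal (Real.exp (2 * Real.log n * (X ω i / r) ^ 2)) ∂P₀ ≤ 2)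
    {M : Matrix (Fin p) (Fin p) ℝ} (hM : M.IsSymm) (hM0 : ∀ i j, 0 ≤ M i j) (hMpos : 0 < ‖M‖)
    (hs : IsDitheredSample X P₀ r Xs τ τ' P) {u : ℝ} (hu : 0 ≤ u) :
    P.real {ω | (n : ℝ)⁻¹ * (2 * √(n * (r ^ 2 * (maxColNorm M ^ 2 * (‖covMatrix X P₀‖ + r ^ 2) +
        4 * r ^ 2 / n * ‖M‖ ^ 2)) * u) + 4 * (r ^ 2 * ‖M‖) * u) + 4 * r ^ 2 / n * ‖M‖ <
      maskedError M (covMatrix X P₀) r Xs τ τ' ω} ≤ 2 * p * Real.exp (-u) := by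
  let : MeasurableSpace (Matrix (Fin p) (Fin p) ℝ) := borel _
  have : BorelSpace (Matrix (Fin p) (Fin p) ℝ) := ⟨rfl⟩
  have hn0 : (0 : ℝ) < n := by positivity
  have hXm := fun k => (hs.identDistrib k).aemeasurable_fst
  have hτm := fun k => aemeasurable_of_isUniform_cube hr (hs.uniform k)
  have hτm' := fun k => aemeasurable_of_isUniform_cube hr (hs.uniform' k)
  have hlaw := fun k => map_eq_uniformCube hr (hs.uniform k)
  have hlaw' := fun k => map_eq_uniformCube hr (hs.uniform' k)
  have hall : ∀ i, AEMeasurable (Sum.elim Xs (Sum.elim τ τ') i) P := by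
    rintro (k | k | k)
    exacts [hXm k, hτm k, hτm' k]
  have hind : ∀ k, IndepFun (Xs k) (τ k) P := fun k =>
    hs.indep.indepFun (i := .inl k) (j := .inr (.inl k)) (by simp)
  have hind' : ∀ k, IndepFun (Xs k) (τ' k) P := fun k =>
    hs.indep.indepFun (i := .inl k) (j := .inr (.inr k)) (by simp)
  have hindτ : ∀ k, IndepFun (τ k) (τ' k) P := fun k =>
    hs.indep.indepFun (i := .inr (.inl k)) (j := .inr (.inr k)) (by simp)
  have hind2 : ∀ k, IndepFun (Xs k) (fun ω => (τ k ω, τ' k ω)) P := fun k =>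
    (hs.indep.indepFun_prodMk₀ hall (.inr (.inl k)) (.inr (.inr k)) (.inl k)
      (by simp) (by simp)).symm
  set B : Fin n → Ω → Matrix (Fin p) (Fin p) ℝ :=
    fun k ω => maskedSummand M r (Xs k ω, τ k ω, τ' k ω) with hB
  have hBm : ∀ k, AEMeasurable (B k) P := fun k => measurable_maskedSummand.comp_aemeasurable
    ((hXm k).prodMk ((hτm k).prodMk (hτm' k)))
  have hBind : iIndepFun B P :=
    (iIndepFun_prodMk_of_sumElim hs.indep hXm hτm hτm').comp (fun _ => maskedSummand M r)
      fun _ => measurable_maskedSummand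
  have hBnorm : ∀ k ω, ‖B k ω‖ ≤ r ^ 2 * ‖M‖ := fun k ω => norm_maskedSummand_le _ hM0
  have hbias := abs_clippedCov_sub_covMatrix_le hn hr hX hexp
  have hmean : ∀ k, ∫ ω, B k ω ∂P = M ⊙ clippedCov r X P₀ := fun k => by
    ext i j
    rw [← integral_matrix_apply (integrable_of_norm_le (hBm k) (hBnorm k)),
      integral_maskedSummand_apply hr (hXm k) (hτm k) (hτm' k) (hlaw k) (hlaw' k) (hindτ k)
      (hind2 k), clippedCov_congr (hs.identDistrib k), Matrix.hadamard_apply]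
  have hbern := measureReal_norm_sum_sub_integral_gt_le hBind hBm
    (fun k ω => isHermitian_maskedSummand _ hM) (by positivity) hBnorm
    (fun k => posSemidef_smul_one_sub_integral_maskedSummand_sq hr (hXm k) (hτm k) (hτm' k)
      (hlaw k) (hlaw' k) (hind k) (hind' k) hM hM0 (β := 4 * r ^ 2 / n) (by positivity)
      (by rw [clippedCov_congr (hs.identDistrib k)]; exact hbias)) hu
  simp only [Fintype.card_fin] at hbern
  refine (measureReal_mono fun ω hω => ?_).trans hbern
  -- The masked bias is dominated entrywise by a multiple of `M`.
  have hbiasM : ‖M ⊙ clippedCov r X P₀ - M ⊙ covMatrix X P₀‖ ≤ 4 * r ^ 2 / n * ‖M‖ := by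
    rw [← Real.norm_of_nonneg (show 0 ≤ 4 * r ^ 2 / (n : ℝ) by positivity), ← norm_smul]
    refine norm_le_norm_of_abs_le fun i j => ?_
    rw [Matrix.sub_apply, Matrix.hadamard_apply, Matrix.hadamard_apply, ← mul_sub, abs_mul,
      abs_of_nonneg (hM0 i j), Matrix.smul_apply, smul_eq_mul, mul_comm]
    exact mul_le_mul_of_nonneg_right (hbias i j) (hM0 i j)
  have hsum : maskedError M (covMatrix X P₀) r Xs τ τ' ω ≤
      (n : ℝ)⁻¹ * ‖∑ k, (B k ω - ∫ ω', B k ω' ∂P)‖ + 4 * r ^ 2 / n * ‖M‖ := by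
    have hdec : M ⊙ dithEstimator r (fun k => Xs k ω) (fun k => τ k ω) (fun k => τ' k ω) -
        M ⊙ covMatrix X P₀ = (n : ℝ)⁻¹ • ∑ k, (B k ω - ∫ ω', B k ω' ∂P) +
        (M ⊙ clippedCov r X P₀ - M ⊙ covMatrix X P₀) := by
      simp only [hmean]
      rw [hadamard_dithEstimator_eq, Finset.sum_sub_distrib, Finset.sum_const, Finset.card_univ,
        Fintype.card_fin, smul_sub, ← Nat.cast_smul_eq_nsmul ℝ, smul_smul, inv_mul_cancel₀ hn0.ne',
        one_smul]
      abel
    rw [maskedError, opNorm_eq_norm, hdec]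
    refine (norm_add_le _ _).trans (add_le_add ?_ hbiasM)
    rw [norm_smul, Real.norm_of_nonneg (by positivity)]
  have hlt := lt_of_lt_of_le hω hsum
  rw [add_lt_add_iff_right] at hlt
  exact lt_of_mul_lt_mul_left hlt (by positivity)

/-- Subadditivity in place of complementation avoids any measurability of `f`. -/
theorem ofReal_one_sub_exp_le_measure_of_measureReal_gt_le {f : Ω → ℝ} {b t : ℝ}
    (h : P.real {ω | b < f ω} ≤ Real.exp (-t)) :
    ENNReal.ofReal (1 - Real.exp (-t)) ≤ P {ω | f ω ≤ b} := by
  have h1 : 1 ≤ P.real {ω | f ω ≤ b} + P.real {ω | b < f ω} := by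
    rw [← probReal_univ (μ := P)]
    refine (measureReal_mono (fun ω _ => ?_)).trans (measureReal_union_le _ _)
    exact (le_or_gt (f ω) b).imp id id
  rw [ENNReal.ofReal_le_iff_le_toReal (measure_ne_top _ _)]
  change _ ≤ P.real _
  linarith

theorem ofReal_le_measure_maskedError_le [NeZero p] (hn : 2 ≤ n) (hr : 0 < r)
    (hX : AEMeasurable X P₀)
    (hexp : ∀ i, ∫⁻ ω, ENNReal.ofReal (Real.exp (2 * Real.log n * (X ω i / r) ^ 2)) ∂P₀ ≤ 2)
    {M : Matrix (Fin p) (Fin p) ℝ} (hM : M.IsSymm) (hM0 : ∀ i j, 0 ≤ M i j)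
    (hs : IsDitheredSample X P₀ r Xs τ τ' P) {t : ℝ} (ht : 0 ≤ t) (hpt : 2 ≤ p ∨ 1 ≤ t) :
    ENNReal.ofReal (1 - Real.exp (-t)) ≤
      P {ω | maskedError M (covMatrix X P₀) r Xs τ τ' ω ≤
        24 * (maxColNorm M * (r * √(opNorm (covMatrix X P₀)) + r ^ 2) *
          √((Real.log p + t) / n) + r ^ 2 * opNorm M * ((Real.log p + t) / n))} := by
  have hn0 : (0 : ℝ) < n := by positivity
  have hp1 : (1 : ℝ) ≤ p := by exact_mod_cast NeZero.one_le
  have hlogp : 0 ≤ Real.log p := Real.log_nonneg hp1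
  -- This lower bound is what excluding `p = 1` with `t < 1` provides.
  have hℓ : Real.log 2 ≤ Real.log p + t := by
    rcases hpt with hp | ht1
    · have : Real.log 2 ≤ Real.log p := Real.log_le_log (by norm_num) (by exact_mod_cast hp)
      linarith
    · linarith [Real.log_two_lt_d9]
  have hlog2 := Real.log_two_gt_d9
  have hm := maxColNorm_nonneg M
  -- Bernstein needs a positive norm bound, so the zero mask is treated apart.
  rcases (norm_nonneg M).eq_or_lt with hM00 | hMpos
  · have hM' : M = 0 := norm_eq_zero.1 hM00.symm
    have herr : ∀ ω, maskedError M (covMatrix X P₀) r Xs τ τ' ω = 0 := fun ω => by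
      rw [maskedError, opNorm_eq_norm, hM', Matrix.zero_hadamard, Matrix.zero_hadamard, sub_zero,
        norm_zero]
    have hb : 0 ≤ 24 * (maxColNorm M * (r * √(opNorm (covMatrix X P₀)) + r ^ 2) *
          √((Real.log p + t) / n) + r ^ 2 * opNorm M * ((Real.log p + t) / n)) := by
      have := norm_nonneg M
      rw [opNorm_eq_norm M]
      positivity
    simp only [herr, hb, Set.ofPred_true, measure_univ]
    exact ENNReal.ofReal_le_one.2 (by linarith [Real.exp_pos (-t)])
  · refine ofReal_one_sub_exp_le_measure_of_measureReal_gt_le ?_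
    -- This exponent turns the prefactor `2 p` into exactly `exp (-t)`, and `log 2 ≤ log p + t`
    -- keeps it below `2 (log p + t)`.
    have hu : 0 ≤ Real.log p + t + Real.log 2 := by linarith
    have h := measureReal_maskedError_gt_le hn hr hX hexp hM hM0 hMpos hs hu
    refine (measureReal_mono (Set.ofPred_subset_ofPred.2 fun ω hω => ?_)).trans (h.trans_eq ?_)
    · exact (deviation_bound_le hn0 hm (norm_nonneg (covMatrix X P₀)) hMpos.le hr.le
        (by linarith) hu (by linarith)).trans_lt hω
    · rw [show -(Real.log p + t + Real.log 2) = -t - Real.log p - Real.log 2 by ring, Real.exp_sub,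
        Real.exp_sub, Real.exp_log (by linarith), Real.exp_log (by norm_num)]
      field_simp

end Deviation

/-- Here `T = ‖Σ‖_∞ ≤ s = ‖Σ‖`, so `T ≤ √(s T)`, and `L = log n ≥ 1/2` gives `√L ≤ 2 L`. Both `r √s`
and `r²` are then of order `L √(s T)`. Using `1 + |a|` keeps the constant positive for every real
`a`. -/
theorem rescaled_bound_le {L m s T R r a q : ℝ} (hL : 1 / 2 ≤ L) (hm : 0 ≤ m) (hT : 0 ≤ T)
    (hTs : T ≤ s) (hR : 0 ≤ R) (hq : 0 ≤ q) (hra : r ^ 2 ≤ a * (L * T)) :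
    24 * (m * (r * √s + r ^ 2) * √q + r ^ 2 * R * q) ≤
      96 * (1 + |a|) * (L * m * √(s * T * q) + L * R * T * q) := by
  have hL0 : 0 < L := by linarith
  have hLT : 0 ≤ L * T := by positivity
  have ha0 : 0 ≤ |a| := abs_nonneg a
  have hs : 0 ≤ s := hT.trans hTs
  have h1 : r ^ 2 ≤ (1 + |a|) * (L * T) :=
    hra.trans (mul_le_mul_of_nonneg_right (by linarith [le_abs_self a]) hLT)
  have hTsq : √(s * T) ^ 2 = s * T := Real.sq_sqrt (by positivity)
  have hTle : T ≤ √(s * T) := Real.le_sqrt_of_sq_le (by nlinarith)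
  have h2 : r * √s ≤ 2 * (1 + |a|) * (L * √(s * T)) := by
    refine le_of_sq_le_sq ?_ (by positivity)
    have h3 : r ^ 2 * s ≤ (1 + |a|) * (L * T) * s := by gcongr
    have h4 : (1 + |a|) * L * (s * T) ≤ (1 + |a|) ^ 2 * (4 * L ^ 2) * (s * T) := by
      gcongr
      · nlinarith
      · nlinarith
    calc (r * √s) ^ 2 = r ^ 2 * s := by rw [mul_pow, Real.sq_sqrt hs]
      _ ≤ (1 + |a|) ^ 2 * (4 * L ^ 2) * (s * T) := by linarith
      _ = (2 * (1 + |a|) * (L * √(s * T))) ^ 2 := by rw [mul_pow, mul_pow, mul_pow, hTsq]; ring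
  have h5 : r ^ 2 ≤ (1 + |a|) * (L * √(s * T)) := h1.trans (by gcongr)
  have h6 : √(s * T * q) = √(s * T) * √q := Real.sqrt_mul (by positivity) q
  have hpos1 : 0 ≤ (1 + |a|) * (L * √(s * T)) * m * √q := by positivity
  have hpos2 : 0 ≤ (1 + |a|) * (L * T) * R * q := by positivity
  rw [h6]
  calc _ ≤ 24 * (m * (2 * (1 + |a|) * (L * √(s * T)) + (1 + |a|) * (L * √(s * T))) * √q +
        (1 + |a|) * (L * T) * R * q) := by gcongr
    _ ≤ _ := by linarith

end DitheredCov

/-! ### The main theorem. -/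

theorem theorem2 (K : ℝ) (hK : 0 < K) :
    ∃ (c C : ℝ) (C' : ℝ → ℝ), 0 < c ∧ 0 < C ∧ (∀ a, 0 < C' a) ∧
      ∀ {Ω₀ : Type*} {Ω : Type*} [MeasurableSpace Ω₀] [MeasurableSpace Ω]
        (P₀ : Measure Ω₀) (P : Measure Ω) [IsProbabilityMeasure P₀] [IsProbabilityMeasure P]
        (n p : ℕ) (_hn : 2 ≤ n) (_hp : 1 ≤ p)
        (X : Ω₀ → Fin p → ℝ) (_hX : DitheredCov.IsSubgaussianVector K X P₀)
        (S : Matrix (Fin p) (Fin p) ℝ) (_hS : S = DitheredCov.covMatrix X P₀)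
        (M : Matrix (Fin p) (Fin p) ℝ) (_hM : M.IsSymm)
        (_hM01 : ∀ i j, M i j ∈ Set.Icc (0 : ℝ) 1)
        (lam : ℝ) (_hlam : 0 < lam)
        (Xs τ τ' : Fin n → Ω → Fin p → ℝ)
        (_hXs : DitheredCov.IsDitheredSample X P₀ lam Xs τ τ' P)
        (t : ℝ) (_ht : 0 ≤ t) (_hpt : 2 ≤ p ∨ 1 ≤ t)
        (_hc : c * (Real.log n * DitheredCov.maxNorm S) ≤ lam ^ 2),
        ENNReal.ofReal (1 - Real.exp (-t)) ≤
          P {ω | DitheredCov.maskedError M S lam Xs τ τ' ω ≤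
            C * (DitheredCov.maxColNorm M *
                (lam * Real.sqrt (DitheredCov.opNorm S) + lam ^ 2) *
                Real.sqrt ((Real.log p + t) / n) +
              lam ^ 2 * DitheredCov.opNorm M * ((Real.log p + t) / n))} ∧
        ∀ a : ℝ, lam ^ 2 ≤ a * (Real.log n * DitheredCov.maxNorm S) →
          ENNReal.ofReal (1 - Real.exp (-t)) ≤
            P {ω | DitheredCov.maskedError M S lam Xs τ τ' ω ≤
              C' a * (Real.log n * DitheredCov.maxColNorm M *
                  Real.sqrt (DitheredCov.opNorm S * DitheredCov.maxNorm S *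
                    (Real.log p + t) / n) +
                Real.log n * DitheredCov.opNorm M * DitheredCov.maxNorm S *
                  ((Real.log p + t) / n))} := by
  refine ⟨4 * K ^ 2, 24, fun a => 96 * (1 + |a|), by positivity, by norm_num,
    fun a => by positivity, ?_⟩
  intro Ω₀ Ω _ _ P₀ P _ _ n p hn hp X hX S hS M hM hM01 lam hlam Xs τ τ' hXs t ht hpt hc
  subst hS
  have : NeZero p := ⟨by omega⟩
  have hmain := DitheredCov.ofReal_le_measure_maskedError_le hn hlam hX.aemeasurable
    (DitheredCov.lintegral_exp_le_two_of_isSubgaussianVector hK hn hX hlam hc) hM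
    (fun i j => (hM01 i j).1) hXs ht hpt
  -- The second event contains the first, since its bound is larger once `lam ^ 2 ≤ a * (log n *
  -- ‖Σ‖_∞)`.
  refine ⟨hmain, fun a ha => hmain.trans (measure_mono (Set.ofPred_subset_ofPred.2 fun ω hω =>
    hω.trans ?_))⟩
  have hlog : 1 / 2 ≤ Real.log n := by
    have h1 : Real.log 2 ≤ Real.log n := Real.log_le_log (by norm_num) (by exact_mod_cast hn)
    linarith [Real.log_two_gt_d9]
  have hp1 : (1 : ℝ) ≤ p := by exact_mod_cast hp
  have hq : 0 ≤ (Real.log p + t) / n := div_nonneg (add_nonneg (Real.log_nonneg hp1) ht) n.cast_nonneg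
  rw [mul_div_assoc (DitheredCov.opNorm _ * DitheredCov.maxNorm _)]
  exact DitheredCov.rescaled_bound_le hlog (DitheredCov.maxColNorm_nonneg M)
    (DitheredCov.maxNorm_nonneg _) (DitheredCov.maxNorm_le_opNorm _) (norm_nonneg _) hq ha
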